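/- **Model.** For each index $k$ (suppressed below) there are $M$ clients, $p$ covariates, $q$ responses (all $\ge 1$), and client $m$ has $n_m\ge1$ observations; $n=\sum_m n_m\to\infty$. All quantities may vary with $k$ except the constants $a,\sigma,c_1,\dots,c_4,\tau>0$, $\alpha\in(0,1/2)$. The model is $Y_m=X_m\Theta^*_m+E_m$ with fixed $X_m\in\mathbb R^{n_m\times p}$, $\Theta_m^*\in\mathbb R^{p\times q}$; write $Y,E\in\mathbb R^{n\times q}$ for the stacked matrices, $\Theta_{m(j)}$ for the $j$th row of $\Theta_m$, and $\|\cdot\|$ for Euclidean/Frobenius norms. For each covariate $j$ the clients are partitioned into nonempty groups $\mathcal G^j_1,\dots,\mathcal G^j_{S_j}$, and $\Theta^*_{m(j)}=\Phi^j_{0s}$ for $m\in\mathcal G^j_s$. Let $S=\sum_jS_j$, $N^j_s=\sum_{m\in\mathcal G^j_s}n_m$, $N_{\min}=\min_{j,s} N_s^j$, $|\mathcal G_{\min}|=\min_{j,s}|\mathcal G^j_s|$. Let $\mathbb X\in\mathbb R^{n\times S}$ be the grouped design: in column $(j,s)$ and in a row of client $m$ it has the $j$th covariate if $m\in\mathcal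 G_s^j$ and $0$ otherwise. Let $K1$ be the set of the $s_k$ groups with $\Phi^j_{0s}\ne0$, $\Phi_{0K1}\in\mathbb R^{s_k\times q}$ the corresponding rows, $\mathbb X_1$ and $\mathbb X_2$ the columns of $\mathbb X$ inside and outside $K1$. Put $r_n=\sqrt{s_kq/N_{\min}}$; $u\gg v$ means that for each constant $C$ eventually $u\ge Cv$. **Estimator.** The SROF objective is $$\ell(\Theta)=\frac1{2M}\sum_{m}\|Y_m-X_m\Theta_m\|^2+\sum_{j}\sum_mp_{\lambda_1}(\|\Theta_{m(j)}\|)+\sum_j\sum_{m\le m'}\tilde p_{\lambda_2}(\|\Theta_{m(j)}-\Theta_{m'(j)}\|).$$ For $\Theta=(\Theta_m)_m$, the group coefficients are $\Phi^j_s=|\mathcal G^j_s|^{-1}\sum_{m\in\mathcal G^j_s}\Theta_{m(j)}$. The oracle estimator has zero rows on the groups outside $K1$, and on $K1$ it is constant on each group with values minimizing $\frac1{2M}\|Y-\mathbb X_1\Phi_{K1}\|^2$. **Assumptions.** (1) Penalties $p_\lambda,\tilde p_\lambda$ ($\lambda>0$) are even, vanish at $0$, are nondecreasing and concave on $[0,\infty)$,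 differentiable on $(0,\infty)$ with derivative nonincreasing in $t$ and nondecreasing in $\lambda$, constant on $[a\lambda,\infty)$, and $\lambda^{-1}p'_\lambda(0+)=1$ (e.g. MCP, SCAD). (2) The entries of $E$ are mutually independent with mean $0$, variance $\sigma^2$ and finite fourth moments; every column $E_l$ satisfies $\Pr(|v^\top E_l|<\|v\|x)\ge1-2e^{-c_1x^2}$ for all $v\ne0$, $x>0$. (3) $\ln S=O(N_{\min}^\alpha)$; $\lambda_1\gg\max\Big\{\frac{n\,r_n}{M|\mathcal G_{\min}|},\ \frac{n\sqrt{q\ln(N_{\min})/N_{\min}^{1-\alpha}}}{M|\mathcal G_{\min}|}\Big\}$. (4) The smallest eigenvalue of $\mathbb X_1^\top\mathbb X_1$ is at least $c_2N_{\min}$; each column of $\mathbb X_2$ has squared norm equal to the sample size $N_s^j$ of its group; each row of $\mathbb X_1$ has squared norm at most $c_3q$; for each client $m$, the largest eigenvalue of $X_{m1}^\top X_{m1}$ is at most $c_4n_m$, where $X_{m1}$ consists of the columns $j$ of $X_m$ with $\Theta^*_{m(j)}\ne0$. (5) Eventually $\lambda_2\ge\big(2\lambda_1\sqrt q+\sqrt{1/c_1}\,\sqrt{s_kq\ln(s_kqn)}/M+\tau\lambda_1|\mathcal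 G_{\min}|\big)/|\mathcal G_{\min}|$; $\lambda_2\gg\sqrt{q/N_{\min}}$; $N_{\min}\gg n^{3/4}q^{1/2}$. (6) Nonzero groups satisfy $\min_{K1}\|\Phi^j_{0s}\|-a\lambda_1\gg r_n$, and $\min_{j:\,S_j>1}\min_{s\ne s'}\|\Phi^j_{0s}-\Phi^j_{0s'}\|-a\lambda_2\gg r_n$ (with $C$ allowed to be any real constant; a minimum over the empty set is $+\infty$). **Conclusion.** There is an estimator $\widehat\Theta$ (the SROF estimator) that, with probability tending to one, is a local minimizer of $\ell$ and equals the oracle estimator, such that, for all deterministic vectors $a_n\in\mathbb R^{s_k}$, $c_n\in\mathbb R^q$ with $\|a_n\|=\|c_n\|=1$, its nonzero-block group coefficients $\widehat\Phi_{K1}$ satisfy $$\widehat\sigma_n(a_n)^{-1}\,a_n^\top(\widehat\Phi_{K1}-\Phi_{0K1})\,c_n\ \xrightarrow{D}\ \mathcal N(0,1),$$ where $\widehat\sigma_n(a_n)=\widehat\sigma\{a_n^\top(\mathbb X_1^\top\mathbb X_1)^{-1}a_n\}^{1/2}$ and $\widehat\sigma^2=\frac1{nq}\|Y-X\widehat\Theta\|^2=\frac{1}{nq}\sum_m\|Y_m-X_m\widehat\Theta_m\|^2$.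 -/

import Mathlib

open MeasureTheory ProbabilityTheory Filter Topology Matrix

noncomputable section

namespace SROF

/-- `u ≫ v` along a sequence: `u` eventually exceeds every constant multiple of `v`. -/
def MuchLarger (u v : ℕ → ℝ) : Prop :=
  ∀ C : ℝ, ∀ᶠ k in atTop, C * v k ≤ u k

/-- A family of penalties `t ↦ pen lam t`, `lam > 0`, of the folded concave type (SCAD, MCP):
even, zero at zero, nondecreasing and concave on `[0, ∞)`, constant on `[a * lam, ∞)`,
with derivative nonincreasing in `t`, nondecreasing in `lam` and tending to `lam` at `0+`. -/
structure IsConcavePenalty (a : ℝ) (pen : ℝ → ℝ → ℝ) : Prop where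
  even : ∀ lam > 0, ∀ t, pen lam (-t) = pen lam t
  zero : ∀ lam > 0, pen lam 0 = 0
  mono : ∀ lam > 0, MonotoneOn (pen lam) (Set.Ici 0)
  concave : ∀ lam > 0, ConcaveOn ℝ (Set.Ici 0) (pen lam)
  const : ∀ lam > 0, ∀ t, a * lam ≤ t → pen lam t = pen lam (a * lam)
  diff : ∀ lam > 0, DifferentiableOn ℝ (pen lam) (Set.Ioi 0)
  deriv_anti : ∀ lam > 0, AntitoneOn (deriv (pen lam)) (Set.Ioi 0)
  deriv_mono : ∀ t > 0, MonotoneOn (fun lam => deriv (pen lam) t) (Set.Ioi 0)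
  deriv_zero : ∀ lam > 0, Tendsto (fun t => lam⁻¹ * deriv (pen lam) t) (𝓝[>] 0) (𝓝 1)

/-- The deterministic data of a federated multivariate linear model with row-wise clusters:
`M` clients with `n m` observations each, `p` covariates, `q` responses, for every covariate `j` a
partition of the clients into `S j` nonempty groups (the group of client `m` is `grp j m`), the true
coefficient vector of each group, and the design (row `⟨m, i⟩` is the `i`th covariate row of
client `m`). -/
structure Federation where
  M : ℕ
  p : ℕ
  q : ℕ
  M_pos : 0 < M
  p_pos : 0 < p
  q_pos : 0 < q
  n : Fin M → ℕ
  n_pos : ∀ m, 0 < n m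
  S : Fin p → ℕ
  grp : (j : Fin p) → Fin M → Fin (S j)
  grp_surj : ∀ j, Function.Surjective (grp j)
  Phi0 : (Σ j : Fin p, Fin (S j)) → EuclideanSpace ℝ (Fin q)
  X : (Σ m : Fin M, Fin (n m)) → Fin p → ℝ

namespace Federation

variable (D : Federation)

/-- Pairs (client, observation): the rows of the stacked response and design matrices. -/
abbrev Obs : Type := Σ m : Fin D.M, Fin (D.n m)

/-- Pairs `(j, s)`: group `s` of covariate `j`. -/
abbrev Group : Type := Σ j : Fin D.p, Fin (D.S j)

/-- The groups with nonzero true coefficient vector (the block `K1`). -/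
abbrev Nonzero : Type := {s : D.Group // D.Phi0 s ≠ 0}

instance : Fintype D.Nonzero := Fintype.ofFinite _

/-- Coefficients: for each client `m` a `p × q` matrix, given by its rows. -/
abbrev Params : Type := Fin D.M → Fin D.p → EuclideanSpace ℝ (Fin D.q)

/-- `n × q` matrices, given by their rows. -/
abbrev Resp : Type := D.Obs → EuclideanSpace ℝ (Fin D.q)

/-- Total sample size `n`. -/
def total : ℕ := ∑ m, D.n m

/-- Number of groups `S = ∑ j, S j`. -/
def numGroups : ℕ := ∑ j, D.S j

/-- Number `s_k` of nonzero groups. -/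
def numNonzero : ℕ := Fintype.card D.Nonzero

/-- The clients in a group. -/
def members (s : D.Group) : Finset (Fin D.M) := {m | D.grp s.1 m = s.2}

/-- The number of observations in a group. -/
def groupN (s : D.Group) : ℕ := ∑ m ∈ D.members s, D.n m

/-- Smallest number of observations in a group. -/
def Nmin : ℕ := ⨅ s, D.groupN s

/-- Smallest number of clients in a group. -/
def Gmin : ℕ := ⨅ s, (D.members s).card

/-- The grouped design matrix `𝕏 = X W`, `n × S`. -/
def design : Matrix D.Obs D.Group ℝ :=
  fun r s => if D.grp s.1 r.1 = s.2 then D.X r s.1 else 0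

/-- The columns of `𝕏` that belong to the nonzero groups. -/
def design₁ : Matrix D.Obs D.Nonzero ℝ := fun r s => D.design r s.1

/-- True coefficients of the clients. -/
def Theta0 : D.Params := fun m j => D.Phi0 ⟨j, D.grp j m⟩

/-- The matrix `X Θ`, with the block `X_m Θ_m` for client `m`. -/
def fit (Th : D.Params) : D.Resp := fun r => ∑ j, D.X r j • Th r.1 j

/-- The responses `Y = X Θ₀ + E`. -/
def response (E : D.Resp) : D.Resp := fun r => D.fit D.Theta0 r + E r

/-- The objective function of sparse row-wise fusion. -/
def objective (pen₁ pen₂ : ℝ → ℝ → ℝ) (lam₁ lam₂ : ℝ) (Y : D.Resp) (Th : D.Params) : ℝ :=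
  (2 * (D.M : ℝ))⁻¹ * ∑ r, ‖Y r - D.fit Th r‖ ^ 2
    + ∑ j, ∑ m, pen₁ lam₁ ‖Th m j‖
    + ∑ j, ∑ m, ∑ m' ∈ Finset.Ici m, pen₂ lam₂ ‖Th m j - Th m' j‖

open Classical in
/-- Coefficients whose groups in the nonzero block are given by `Phi` and that vanish elsewhere. -/
def ofNonzero (Phi : D.Nonzero → EuclideanSpace ℝ (Fin D.q)) : D.Params :=
  fun m j => if h : D.Phi0 ⟨j, D.grp j m⟩ ≠ 0 then Phi ⟨⟨j, D.grp j m⟩, h⟩ else 0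

/-- `Th` is the oracle estimator: the least squares fit among the coefficients that have the true
group structure and the true zero groups. -/
def IsOracle (Y : D.Resp) (Th : D.Params) : Prop :=
  ∃ Phi : D.Nonzero → EuclideanSpace ℝ (Fin D.q), Th = D.ofNonzero Phi ∧
    ∀ Psi : D.Nonzero → EuclideanSpace ℝ (Fin D.q),
      (2 * (D.M : ℝ))⁻¹ * ∑ r, ‖Y r - ∑ s, D.design₁ r s • Phi s‖ ^ 2
        ≤ (2 * (D.M : ℝ))⁻¹ * ∑ r, ‖Y r - ∑ s, D.design₁ r s • Psi s‖ ^ 2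

/-- Group coefficients of `Th`: the average over the group of the rows of `Th`
(the common value when `Th` is constant on the group). -/
def groupCoef (Th : D.Params) (s : D.Group) : EuclideanSpace ℝ (Fin D.q) :=
  ((D.members s).card : ℝ)⁻¹ • ∑ m ∈ D.members s, Th m s.1

/-- `aᵀ (Φ̂_{K1} - Φ_{0 K1}) c` with `Φ̂` the group coefficients of `Th`. -/
def contrast (a : EuclideanSpace ℝ D.Nonzero) (c : EuclideanSpace ℝ (Fin D.q))
    (Th : D.Params) : ℝ :=
  ∑ s, ∑ l, a s * (D.groupCoef Th s.1 l - D.Phi0 s.1 l) * c l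

/-- Residual variance per scalar response: `(n q)⁻¹ ‖Y - X Θ‖²`. -/
def sigmaSq (Y : D.Resp) (Th : D.Params) : ℝ :=
  ((D.total : ℝ) * (D.q : ℝ))⁻¹ * ∑ r, ‖Y r - D.fit Th r‖ ^ 2

/-- The standard error `σ̂ {aᵀ (𝕏₁ᵀ 𝕏₁)⁻¹ a}^{1/2}`. -/
def stdErr (a : EuclideanSpace ℝ D.Nonzero) (Y : D.Resp) (Th : D.Params) : ℝ :=
  √(D.sigmaSq Y Th) * √(a.ofLp ⬝ᵥ ((D.design₁ᵀ * D.design₁)⁻¹ *ᵥ a.ofLp))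

/-- The rate `√(s_k q / N_min)`. -/
def rate : ℝ := √((D.numNonzero : ℝ) * (D.q : ℝ) / (D.Nmin : ℝ))

/-- Conditions on the (fixed) design. The first and the last one bound the smallest eigenvalue of
`𝕏₁ᵀ 𝕏₁` below by `c₂ N_min` and, for every client `m`, the largest eigenvalue of `X_{m1}ᵀ X_{m1}`
above by `c₄ n_m`, where `X_{m1}` holds the columns of `X_m` with nonzero true coefficients. -/
structure DesignCond (c₂ c₃ c₄ : ℝ) : Prop where
  min_eigenvalue :
    (D.design₁ᵀ * D.design₁ - (c₂ * (D.Nmin : ℝ)) • (1 : Matrix D.Nonzero D.Nonzero ℝ)).PosSemidef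
  zero_col : ∀ s : D.Group, D.Phi0 s = 0 → ∑ r, D.design r s ^ 2 = (D.groupN s : ℝ)
  row : ∀ r, ∑ s, D.design₁ r s ^ 2 ≤ c₃ * (D.q : ℝ)
  max_eigenvalue : ∀ (m : Fin D.M) (v : Fin D.p → ℝ), (∀ j, D.Theta0 m j = 0 → v j = 0) →
    ∑ i, (∑ j, D.X ⟨m, i⟩ j * v j) ^ 2 ≤ c₄ * (D.n m : ℝ) * ∑ j, v j ^ 2

/-- Conditions on the noise matrix `E`: independent centred entries with variance `sigma ^ 2` and
finite fourth moments, and columns with sub-Gaussian linear forms. -/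
structure NoiseCond {Ω : Type*} [MeasurableSpace Ω] (μ : Measure Ω) (sigma c₁ : ℝ)
    (E : Ω → D.Resp) : Prop where
  meas : Measurable E
  indep : iIndepFun (fun (rl : D.Obs × Fin D.q) ω => E ω rl.1 rl.2) μ
  memLp : ∀ r l, MemLp (fun ω => E ω r l) 4 μ
  mean : ∀ r l, ∫ ω, E ω r l ∂μ = 0
  var : ∀ r l, ∫ ω, (E ω r l) ^ 2 ∂μ = sigma ^ 2
  subgaussian : ∀ (l : Fin D.q) (v : EuclideanSpace ℝ D.Obs), v ≠ 0 → ∀ x > 0,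
    1 - 2 * Real.exp (-c₁ * x ^ 2) ≤ μ.real {ω | |∑ r, v r * E ω r l| < ‖v‖ * x}

end Federation

end SROF

end

/-!
The estimator is the oracle least squares fit itself, `Φ̂ = (𝕏₁ᵀ 𝕏₁)⁻¹ 𝕏₁ᵀ Y`, extended by zero
(`SROF.Federation.oracle`). It is linear in the responses, hence measurable, and it is the oracle
estimator on every sample point. Two facts remain.

*Local minimality with probability tending to one.* Perturb the oracle by a small `Δ`. The signal
conditions put the rows of nonzero groups, and the differences of rows of different groups, strictly
inside the flat part of their penalties. Only rows in zero groups and differences within a group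
are penalized, and near zero the slope is at least half of `lam₁`, `lam₂` by concavity. The
quadratic loss changes by at least `-M⁻¹ ∑ ⟨X_{m(j)}ᵀ R_m, Δ_{m(j)}⟩`, with `R` the oracle
residuals. Within a group this linear form splits into an average over pairs of clients, which the
fusion penalty dominates, and a term in the group sum of the score (`sum_inner_le_of_group`). That
sum vanishes on nonzero groups by the normal equations, and on zero groups the sparsity penalty
dominates it (`isLocalMin_oracle`). The score is linear in the noise with coefficient vectors of
squared norm `O(n)`, so a union bound over the groups, the client columns and the responses keeps it
below any fixed multiple of `lam₁ * M * Gmin`, and the condition `τ * lam₁ ≤ lam₂` transfers this to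
the fusion penalty. The coefficient error has second moment `O(rate ^ 2)` because
`tr (𝕏₁ᵀ 𝕏₁)⁻¹ ≤ s_k / (c₂ Nmin)`.

*Asymptotic normality.* A contrast is a weighted sum of independent noise entries with weights
`w_r c_l`, `w = 𝕏₁ (𝕏₁ᵀ 𝕏₁)⁻¹ a`. Relative to `‖w‖`, no weight exceeds the leverage bound
`√(c₃ q / (c₂ Nmin))`, which tends to zero since `Nmin ≫ n ^ (3 / 4) * q ^ (1 / 2)` and
`Nmin ≤ n`. The sub-Gaussian tails bound the fourth moments uniformly, and comparing characteristic
functions factor by factor gives a central limit theorem with explicit error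
(`norm_charFun_weighted_sum_sub_gaussian_le`). The residual variance is the mean square of the
noise, which obeys a law of large numbers, minus a projection term with mean `σ² s_k / n`; the trace
of `𝕏₁ᵀ 𝕏₁` gives `s_k / n = O(q / Nmin)`. Replacing the variance by its estimate is then harmless
(`tendstoInDistribution_mul_of_tendsto_charFun`, for probability spaces that vary with the index).
-/

noncomputable section

namespace SROF

/-! ### A central limit theorem for weighted sums -/

lemma norm_prod_sub_prod_le_sum {ι : Type*} (s : Finset ι) (z w : ι → ℂ)
    (hz : ∀ i ∈ s, ‖z i‖ ≤ 1) (hw : ∀ i ∈ s, ‖w i‖ ≤ 1) :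
    ‖∏ i ∈ s, z i - ∏ i ∈ s, w i‖ ≤ ∑ i ∈ s, ‖z i - w i‖ := by
  classical
  induction s using Finset.induction_on with
  | empty => simp
  | insert i s hi ih =>
    rw [Finset.prod_insert hi, Finset.prod_insert hi, Finset.sum_insert hi]
    have h1 : z i * ∏ j ∈ s, z j - w i * ∏ j ∈ s, w j
        = (z i - w i) * ∏ j ∈ s, z j + w i * (∏ j ∈ s, z j - ∏ j ∈ s, w j) := by ring
    have h2 : ‖∏ j ∈ s, z j‖ ≤ 1 := by
      rw [norm_prod]
      exact Finset.prod_le_one (fun _ _ => norm_nonneg _)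
        fun j hj => hz j (Finset.mem_insert_of_mem hj)
    have h3 := ih (fun j hj => hz j (Finset.mem_insert_of_mem hj))
      (fun j hj => hw j (Finset.mem_insert_of_mem hj))
    have h4 := hw i (Finset.mem_insert_self i s)
    rw [h1]
    refine (norm_add_le _ _).trans ?_
    rw [norm_mul, norm_mul]
    refine add_le_add ?_ ?_
    · exact mul_le_of_le_one_right (norm_nonneg _) h2
    · exact (mul_le_of_le_one_left (norm_nonneg _) h4).trans h3

lemma norm_exp_mul_I_sub_taylor_le (x : ℝ) :
    ‖Complex.exp (x * Complex.I) - (1 + x * Complex.I - x ^ 2 / 2)‖ ≤ 4 * |x| ^ 3 := by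
  have hn : ‖(x * Complex.I : ℂ)‖ = |x| := by simp
  rcases le_or_gt |x| 1 with h | h
  · have := Complex.exp_bound (x := x * Complex.I) (by rw [hn]; exact h) (n := 3) (by norm_num)
    rw [hn] at this
    have e : ∑ m ∈ Finset.range 3, (x * Complex.I : ℂ) ^ m / (m.factorial : ℂ)
        = 1 + x * Complex.I - x ^ 2 / 2 := by
      simp [Finset.sum_range_succ, mul_pow]
      ring
    rw [e] at this
    refine this.trans ?_
    have : 0 ≤ |x| ^ 3 := by positivity
    norm_num [Nat.factorial]
    linarith
  · have h1 : ‖Complex.exp (x * Complex.I)‖ = 1 := Complex.norm_exp_ofReal_mul_I x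
    have h2 : ‖(1 + x * Complex.I - x ^ 2 / 2 : ℂ)‖ ≤ 1 + |x| + |x| ^ 2 / 2 := by
      refine (norm_sub_le _ _).trans (add_le_add ((norm_add_le _ _).trans ?_) ?_)
      · simp
      · simp
    refine (norm_sub_le _ _).trans ?_
    rw [h1]
    have h3 : |x| ≤ |x| ^ 3 := le_self_pow₀ h.le (by norm_num)
    have h4 : |x| ^ 2 ≤ |x| ^ 3 := by nlinarith [sq_nonneg |x|]
    linarith

lemma abs_exp_neg_sub_le {y : ℝ} (hy : 0 ≤ y) : |Real.exp (-y) - (1 - y)| ≤ y ^ 2 := by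
  rcases le_or_gt y 1 with h | h
  · have := Real.abs_exp_sub_one_sub_id_le (x := -y) (by rw [abs_neg, abs_of_nonneg hy]; exact h)
    have e : Real.exp (-y) - 1 - -y = Real.exp (-y) - (1 - y) := by ring
    rwa [e, neg_sq] at this
  · have h1 : Real.exp (-y) ≤ 1 := Real.exp_le_one_iff.2 (by linarith)
    have h2 := Real.exp_pos (-y)
    rw [abs_le]
    constructor <;> nlinarith

section Moments

variable {Ω : Type*} [MeasurableSpace Ω] {μ : Measure Ω} [IsProbabilityMeasure μ]

lemma integrable_pow_of_memLp_four {X : Ω → ℝ} (hX : MemLp X 4 μ) {n : ℕ} (hn : n ≤ 4) :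
    Integrable (fun ω => X ω ^ n) μ := by
  have h : MemLp X (n : ENNReal) μ := hX.mono_exponent (by exact_mod_cast hn)
  have := h.integrable_norm_pow'
  refine this.mono' (hX.aestronglyMeasurable.pow n) ?_
  filter_upwards with ω
  simp

lemma integrable_abs_pow_three {X : Ω → ℝ} (hX : MemLp X 4 μ) :
    Integrable (fun ω => |X ω| ^ 3) μ := by
  simpa using (integrable_pow_of_memLp_four hX (n := 3) (by norm_num)).abs

lemma integral_abs_pow_three_le {X : Ω → ℝ} (hX : MemLp X 4 μ) :
    ∫ ω, |X ω| ^ 3 ∂μ ≤ ∫ ω, X ω ^ 2 ∂μ + ∫ ω, X ω ^ 4 ∂μ := by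
  rw [← integral_add (integrable_pow_of_memLp_four hX (by norm_num))
    (integrable_pow_of_memLp_four hX (by norm_num))]
  refine integral_mono (integrable_abs_pow_three hX)
    ((integrable_pow_of_memLp_four hX (by norm_num)).add
      (integrable_pow_of_memLp_four hX (by norm_num))) fun ω => ?_
  have h2 : X ω ^ 2 = |X ω| ^ 2 := (sq_abs _).symm
  have h4 : X ω ^ 4 = |X ω| ^ 4 := by rw [← abs_pow, abs_of_nonneg (by positivity)]
  simp only [h2, h4]
  have h0 := abs_nonneg (X ω)
  nlinarith [mul_nonneg (sq_nonneg |X ω|) (sq_nonneg (|X ω| - 1)), pow_nonneg h0 3]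

/-- A centred variable has a characteristic function close to that of the Gaussian law with the
same variance. -/
lemma norm_charFun_sub_gaussian_le {X : Ω → ℝ} (hX : MemLp X 4 μ) (hmean : ∫ ω, X ω ∂μ = 0)
    (t : ℝ) :
    ‖charFun (μ.map X) t - Complex.exp (-(t ^ 2 * (∫ ω, X ω ^ 2 ∂μ) / 2 : ℝ))‖
      ≤ 4 * |t| ^ 3 * ∫ ω, |X ω| ^ 3 ∂μ + (t ^ 2 * (∫ ω, X ω ^ 2 ∂μ) / 2) ^ 2 := by
  set v := ∫ ω, X ω ^ 2 ∂μ with hv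
  have hv0 : 0 ≤ v := integral_nonneg fun ω => sq_nonneg _
  have hXm : AEMeasurable X μ := hX.aestronglyMeasurable.aemeasurable
  have hi1 : Integrable X μ := by
    simpa using integrable_pow_of_memLp_four hX (n := 1) (by norm_num)
  have hi2 := integrable_pow_of_memLp_four hX (n := 2) (by norm_num)
  have hchar : charFun (μ.map X) t = ∫ ω, Complex.exp ((t * X ω : ℝ) * Complex.I) ∂μ := by
    rw [charFun_apply_real, integral_map hXm (by fun_prop)]
    simp
  have hexp : Integrable (fun ω => Complex.exp ((t * X ω : ℝ) * Complex.I)) μ := by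
    refine Integrable.of_bound (C := 1) ?_ ?_
    · exact AEMeasurable.aestronglyMeasurable (by fun_prop)
    · filter_upwards with ω
      rw [Complex.norm_exp_ofReal_mul_I]
  have hiL : Integrable (fun ω => ((t * X ω : ℝ) : ℂ) * Complex.I) μ :=
    ((hi1.const_mul t).ofReal).mul_const _
  have hiQ : Integrable (fun ω => ((t * X ω : ℝ) : ℂ) ^ 2 / 2) μ := by
    have : Integrable (fun ω => ((t ^ 2 / 2 * X ω ^ 2 : ℝ) : ℂ)) μ := (hi2.const_mul _).ofReal
    refine this.congr ?_
    filter_upwards with ω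
    push_cast
    ring
  have hiA : Integrable (fun ω => 1 + ((t * X ω : ℝ) : ℂ) * Complex.I) μ :=
    (integrable_const (1 : ℂ)).add hiL
  have hiP : Integrable
      (fun ω => 1 + ((t * X ω : ℝ) : ℂ) * Complex.I - ((t * X ω : ℝ) : ℂ) ^ 2 / 2) μ :=
    hiA.sub hiQ
  have hpoly : ∫ ω, (1 + ((t * X ω : ℝ) : ℂ) * Complex.I - ((t * X ω : ℝ) : ℂ) ^ 2 / 2) ∂μ
      = ((1 - t ^ 2 * v / 2 : ℝ) : ℂ) := by
    rw [integral_sub hiA hiQ, integral_add (integrable_const _) hiL]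
    have e1 : ∫ ω, ((t * X ω : ℝ) : ℂ) * Complex.I ∂μ = 0 := by
      rw [integral_mul_const, integral_complex_ofReal, integral_const_mul, hmean]
      simp
    have e2 : ∫ ω, ((t * X ω : ℝ) : ℂ) ^ 2 / 2 ∂μ = ((t ^ 2 * v / 2 : ℝ) : ℂ) := by
      have : ∀ ω, ((t * X ω : ℝ) : ℂ) ^ 2 / 2 = ((t ^ 2 / 2 * X ω ^ 2 : ℝ) : ℂ) := by
        intro ω; push_cast; ring
      simp_rw [this]
      rw [integral_complex_ofReal, integral_const_mul, ← hv]
      congr 1; ring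
    rw [e1, e2]
    simp
  have h1 : ‖charFun (μ.map X) t - ((1 - t ^ 2 * v / 2 : ℝ) : ℂ)‖
      ≤ 4 * |t| ^ 3 * ∫ ω, |X ω| ^ 3 ∂μ := by
    rw [hchar, ← hpoly, ← integral_sub hexp hiP,
      ← integral_const_mul]
    refine norm_integral_le_of_norm_le ((integrable_abs_pow_three hX).const_mul _) ?_
    filter_upwards with ω
    refine (norm_exp_mul_I_sub_taylor_le (t * X ω)).trans (le_of_eq ?_)
    rw [abs_mul, mul_pow]; ring
  have h2 : ‖((1 - t ^ 2 * v / 2 : ℝ) : ℂ) - Complex.exp (-(t ^ 2 * v / 2 : ℝ))‖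
      ≤ (t ^ 2 * v / 2) ^ 2 := by
    have : ((1 - t ^ 2 * v / 2 : ℝ) : ℂ) - Complex.exp (-(t ^ 2 * v / 2 : ℝ))
        = (((1 - t ^ 2 * v / 2) - Real.exp (-(t ^ 2 * v / 2)) : ℝ) : ℂ) := by push_cast; ring
    rw [this, Complex.norm_real, Real.norm_eq_abs, abs_sub_comm]
    exact abs_exp_neg_sub_le (by positivity)
  calc _ = ‖(charFun (μ.map X) t - ((1 - t ^ 2 * v / 2 : ℝ) : ℂ))
        + (((1 - t ^ 2 * v / 2 : ℝ) : ℂ) - Complex.exp (-(t ^ 2 * v / 2 : ℝ)))‖ := by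
          congr 1; ring
    _ ≤ _ := (norm_add_le _ _).trans (add_le_add h1 h2)

/-- Quantitative central limit theorem for a weighted sum with unit variance: the distance to
the Gaussian characteristic function is controlled by the largest weight `β`. -/
lemma norm_charFun_weighted_sum_sub_gaussian_le {ι : Type*} [Fintype ι] {X : ι → Ω → ℝ}
    {sigma K β : ℝ} (hsigma : 0 < sigma) (hindep : iIndepFun X μ) (hX : ∀ i, MemLp (X i) 4 μ)
    (hmean : ∀ i, ∫ ω, X i ω ∂μ = 0) (hvar : ∀ i, ∫ ω, X i ω ^ 2 ∂μ = sigma ^ 2)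
    (hfour : ∀ i, ∫ ω, X i ω ^ 4 ∂μ ≤ K) (b : ι → ℝ) (hb : ∑ i, b i ^ 2 * sigma ^ 2 = 1)
    (hβ : ∀ i, |b i| ≤ β) (t : ℝ) :
    ‖charFun (μ.map fun ω => ∑ i, b i * X i ω) t - Complex.exp (-(t ^ 2 / 2 : ℝ))‖
      ≤ β * (4 * |t| ^ 3 * ((sigma ^ 2 + K) / sigma ^ 2)) + β ^ 2 * (t ^ 4 * sigma ^ 2 / 4) := by
  have hbX : ∀ i, MemLp (fun ω => b i * X i ω) 4 μ := fun i => (hX i).const_mul (b i)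
  have hmeas : ∀ i, AEMeasurable (fun ω => b i * X i ω) μ :=
    fun i => (hbX i).aestronglyMeasurable.aemeasurable
  have hind : iIndepFun (fun i ω => b i * X i ω) μ :=
    hindep.comp (fun i x => b i * x) fun i => by fun_prop
  have hv : ∀ i, ∫ ω, (b i * X i ω) ^ 2 ∂μ = b i ^ 2 * sigma ^ 2 := fun i => by
    simp_rw [mul_pow]
    rw [integral_const_mul, hvar]
  have hm : ∀ i, ∫ ω, b i * X i ω ∂μ = 0 := fun i => by rw [integral_const_mul, hmean, mul_zero]
  have hgauss : Complex.exp (-(t ^ 2 / 2 : ℝ))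
      = ∏ i, Complex.exp (-(t ^ 2 * (∫ ω, (b i * X i ω) ^ 2 ∂μ) / 2 : ℝ)) := by
    rw [← Complex.exp_sum]
    congr 1
    simp_rw [hv]
    rw [← Complex.ofReal_neg]
    simp_rw [← Complex.ofReal_neg]
    rw [← Complex.ofReal_sum]
    congr 1
    have : ∑ i, -(t ^ 2 * (b i ^ 2 * sigma ^ 2) / 2)
        = -(t ^ 2 / 2) * ∑ i, b i ^ 2 * sigma ^ 2 := by
      rw [Finset.mul_sum]
      exact Finset.sum_congr rfl fun i _ => by ring
    rw [this, hb, mul_one]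
  rw [hind.charFun_map_fun_sum_eq_prod hmeas, hgauss, Finset.prod_apply]
  refine (norm_prod_sub_prod_le_sum _ _ _ (fun i _ => ?_) fun i _ => ?_).trans ?_
  · have : IsProbabilityMeasure (μ.map fun ω => b i * X i ω) :=
      Measure.isProbabilityMeasure_map (hmeas i)
    exact norm_charFun_le_one _
  · rw [← Complex.ofReal_neg, ← Complex.ofReal_exp, Complex.norm_real, Real.norm_eq_abs,
      abs_of_nonneg (Real.exp_pos _).le]
    refine Real.exp_le_one_iff.2 ?_
    rw [hv]
    have : 0 ≤ t ^ 2 * (b i ^ 2 * sigma ^ 2) / 2 := by positivity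
    linarith
  have hs2 : 0 < sigma ^ 2 := by positivity
  have hbsum : ∑ i, b i ^ 2 = 1 / sigma ^ 2 := by
    rw [← Finset.sum_mul] at hb
    exact eq_div_of_mul_eq hs2.ne' hb
  have hterm : ∀ i, ‖charFun (μ.map fun ω => b i * X i ω) t
      - Complex.exp (-(t ^ 2 * (∫ ω, (b i * X i ω) ^ 2 ∂μ) / 2 : ℝ))‖
      ≤ b i ^ 2 * (β * (4 * |t| ^ 3 * (sigma ^ 2 + K)) + β ^ 2 * (t ^ 4 * sigma ^ 4 / 4)) := by
    intro i
    refine (norm_charFun_sub_gaussian_le (hbX i) (hm i) t).trans ?_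
    rw [hv]
    have h3 : ∫ ω, |b i * X i ω| ^ 3 ∂μ ≤ b i ^ 2 * β * (sigma ^ 2 + K) := by
      simp_rw [abs_mul, mul_pow]
      rw [integral_const_mul]
      have h4 : ∫ ω, |X i ω| ^ 3 ∂μ ≤ sigma ^ 2 + K :=
        (integral_abs_pow_three_le (hX i)).trans (by rw [hvar]; linarith [hfour i])
      have h5 : 0 ≤ ∫ ω, |X i ω| ^ 3 ∂μ := integral_nonneg fun ω => by positivity
      have h6 : |b i| ^ 3 ≤ b i ^ 2 * β := by
        rw [pow_succ, sq_abs]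
        exact mul_le_mul_of_nonneg_left (hβ i) (sq_nonneg _)
      exact mul_le_mul h6 h4 h5 ((by positivity : (0 : ℝ) ≤ |b i| ^ 3).trans h6)
    have h7 : b i ^ 2 ≤ β ^ 2 := sq_le_sq' (by linarith [neg_abs_le (b i), hβ i])
      ((le_abs_self _).trans (hβ i))
    have h8 : 0 ≤ 4 * |t| ^ 3 := by positivity
    have h9 : b i ^ 2 * b i ^ 2 * (t ^ 4 * sigma ^ 4 / 4)
        ≤ b i ^ 2 * β ^ 2 * (t ^ 4 * sigma ^ 4 / 4) := by
      gcongr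
    nlinarith [mul_le_mul_of_nonneg_left h3 h8]
  refine (Finset.sum_le_sum fun i _ => hterm i).trans (le_of_eq ?_)
  rw [← Finset.sum_mul, hbsum]
  field_simp

/-- Replacing `Z` by a multiple `W * Z` changes the characteristic function little when the two
variables are close with high probability. -/
lemma norm_charFun_mul_sub_le {W Z : Ω → ℝ} (hW : AEMeasurable W μ) (hZ : AEMeasurable Z μ)
    (t : ℝ) {ε : ℝ} (hε : 0 ≤ ε) :
    ‖charFun (μ.map fun ω => W ω * Z ω) t - charFun (μ.map Z) t‖
      ≤ |t| * ε + 2 * μ.real {ω | ε < |W ω * Z ω - Z ω|} := by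
  have hexp : ∀ {V : Ω → ℝ}, AEMeasurable V μ →
      Integrable (fun ω => Complex.exp ((t * V ω : ℝ) * Complex.I)) μ := by
    intro V hV
    refine Integrable.of_bound (C := 1) ?_ ?_
    · exact AEMeasurable.aestronglyMeasurable (by fun_prop)
    · filter_upwards with ω
      rw [Complex.norm_exp_ofReal_mul_I]
  have hchar : ∀ {V : Ω → ℝ}, AEMeasurable V μ →
      charFun (μ.map V) t = ∫ ω, Complex.exp ((t * V ω : ℝ) * Complex.I) ∂μ := by
    intro V hV
    rw [charFun_apply_real, integral_map hV (by fun_prop)]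
    simp
  have hWZ : AEMeasurable (fun ω => W ω * Z ω) μ := hW.mul hZ
  have hset : NullMeasurableSet {ω | ε < |W ω * Z ω - Z ω|} μ :=
    nullMeasurableSet_lt (by fun_prop) (by fun_prop)
  rw [hchar hWZ, hchar hZ, ← integral_sub (hexp hWZ) (hexp hZ)]
  have hint : Integrable (fun ω => |t| * ε
      + 2 * Set.indicator {ω | ε < |W ω * Z ω - Z ω|} (fun _ => (1 : ℝ)) ω) μ :=
    (integrable_const _).add (((integrable_const (1 : ℝ)).indicator₀ hset).const_mul 2)
  refine (norm_integral_le_of_norm_le hint ?_).trans (le_of_eq ?_)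
  · filter_upwards with ω
    by_cases h : ε < |W ω * Z ω - Z ω|
    · rw [Set.indicator_of_mem (by exact h)]
      have : ‖Complex.exp ((t * (W ω * Z ω) : ℝ) * Complex.I)
          - Complex.exp ((t * Z ω : ℝ) * Complex.I)‖ ≤ 2 := by
        refine (norm_sub_le _ _).trans ?_
        rw [Complex.norm_exp_ofReal_mul_I, Complex.norm_exp_ofReal_mul_I]
        norm_num
      have h0 : 0 ≤ |t| * ε := by positivity
      linarith
    · rw [Set.indicator_of_notMem (by exact h)]
      have hfac : Complex.exp ((t * (W ω * Z ω) : ℝ) * Complex.I)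
          - Complex.exp ((t * Z ω : ℝ) * Complex.I)
          = Complex.exp ((t * Z ω : ℝ) * Complex.I)
            * (Complex.exp (Complex.I * (t * (W ω * Z ω - Z ω) : ℝ)) - 1) := by
        rw [mul_sub, ← Complex.exp_add, mul_one]
        congr 2
        push_cast
        ring
      rw [hfac, norm_mul, Complex.norm_exp_ofReal_mul_I, one_mul]
      refine Real.norm_exp_I_mul_ofReal_sub_one_le.trans ?_
      rw [Real.norm_eq_abs, abs_mul, mul_zero, add_zero]
      exact mul_le_mul_of_nonneg_left (not_lt.1 h) (abs_nonneg t)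
  · rw [integral_add (integrable_const _)
        (((integrable_const (1 : ℝ)).indicator₀ hset).const_mul 2),
      integral_const_mul 2, integral_indicator₀ hset]
    simp

end Moments

/-! ### Moment bounds, a law of large numbers and random normalization -/

/-- Fourth moments are bounded uniformly over all variables with a given sub-Gaussian tail. -/
lemma exists_fourth_moment_bound {c : ℝ} (hc : 0 < c) :
    ∃ K : ℝ, 0 ≤ K ∧ ∀ {Ω : Type*} [MeasurableSpace Ω] (μ : Measure Ω) [IsProbabilityMeasure μ]
      (X : Ω → ℝ), AEMeasurable X μ →
      (∀ x > 0, μ.real {ω | x ≤ |X ω|} ≤ 2 * Real.exp (-c * x ^ 2)) →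
      ∫ ω, X ω ^ 4 ∂μ ≤ K := by
  have hint : IntegrableOn (fun t : ℝ => 2 * (t ^ (3 : ℝ) * Real.exp (-c * t ^ 2))) (Set.Ioi 0) :=
    ((integrable_rpow_mul_exp_neg_mul_sq hc (s := 3) (by norm_num)).const_mul 2).integrableOn
  have hnn : 0 ≤ ∫ t in Set.Ioi (0 : ℝ), 2 * (t ^ (3 : ℝ) * Real.exp (-c * t ^ 2)) := by
    refine setIntegral_nonneg measurableSet_Ioi fun t ht => ?_
    have : 0 < t := ht
    positivity
  refine ⟨4 * ∫ t in Set.Ioi (0 : ℝ), 2 * (t ^ (3 : ℝ) * Real.exp (-c * t ^ 2)), by positivity,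
    fun {Ω} _ μ _ X hX htail => ?_⟩
  have h1 := lintegral_rpow_eq_lintegral_meas_le_mul μ (f := fun ω => |X ω|)
    (Eventually.of_forall fun ω => abs_nonneg _) hX.abs (p := 4) (by norm_num)
  have h2 : ∫⁻ t in Set.Ioi (0 : ℝ), μ {ω | t ≤ |X ω|} * ENNReal.ofReal (t ^ ((4 : ℝ) - 1))
      ≤ ∫⁻ t in Set.Ioi (0 : ℝ), ENNReal.ofReal (2 * (t ^ (3 : ℝ) * Real.exp (-c * t ^ 2))) := by
    refine setLIntegral_mono' measurableSet_Ioi fun t ht => ?_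
    have h3 : μ {ω | t ≤ |X ω|} ≤ ENNReal.ofReal (2 * Real.exp (-c * t ^ 2)) := by
      rw [← ofReal_measureReal]
      exact ENNReal.ofReal_le_ofReal (htail t ht)
    have ht' : (0 : ℝ) < t := ht
    refine (mul_le_mul_left h3 _).trans ?_
    rw [← ENNReal.ofReal_mul (by positivity)]
    refine ENNReal.ofReal_le_ofReal (le_of_eq ?_)
    norm_num
    ring
  rw [← ofReal_integral_eq_lintegral_ofReal hint (by
    filter_upwards [self_mem_ae_restrict measurableSet_Ioi] with t ht
    have : (0 : ℝ) < t := ht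
    positivity)] at h2
  have h4 : ∀ ω, |X ω| ^ (4 : ℝ) = X ω ^ 4 := fun ω => by
    rw [show (4 : ℝ) = ((4 : ℕ) : ℝ) by norm_num, Real.rpow_natCast, ← abs_pow,
      abs_of_nonneg (by positivity)]
  simp_rw [h4] at h1
  rw [integral_eq_lintegral_of_nonneg_ae (Eventually.of_forall fun ω => by positivity)
    (hX.pow_const 4).aestronglyMeasurable, h1]
  refine ENNReal.toReal_le_of_le_ofReal (by positivity) ?_
  rw [ENNReal.ofReal_mul (by norm_num)]
  gcongr

section SquaredMoments

variable {Ω : Type*} [MeasurableSpace Ω] {μ : Measure Ω} [IsProbabilityMeasure μ]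
  {ι : Type*} [Fintype ι] {X : ι → Ω → ℝ} {sigma : ℝ}

lemma memLp_two_of_memLp_four {X : Ω → ℝ} (hX : MemLp X 4 μ) : MemLp X 2 μ :=
  hX.mono_exponent (by norm_num)

lemma integrable_sq_weighted_sum (hX : ∀ i, MemLp (X i) 4 μ) (b : ι → ℝ) :
    Integrable (fun ω => (∑ i, b i * X i ω) ^ 2) μ :=
  (memLp_finsetSum _ fun i _ => (memLp_two_of_memLp_four (hX i)).const_mul (b i)).integrable_sq

lemma integral_sq_weighted_sum (hindep : iIndepFun X μ) (hX : ∀ i, MemLp (X i) 4 μ)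
    (hmean : ∀ i, ∫ ω, X i ω ∂μ = 0) (hvar : ∀ i, ∫ ω, X i ω ^ 2 ∂μ = sigma ^ 2) (b : ι → ℝ) :
    ∫ ω, (∑ i, b i * X i ω) ^ 2 ∂μ = sigma ^ 2 * ∑ i, b i ^ 2 := by
  have hL2 : ∀ i, MemLp (fun ω => b i * X i ω) 2 μ :=
    fun i => (memLp_two_of_memLp_four (hX i)).const_mul (b i)
  have hind : iIndepFun (fun i ω => b i * X i ω) μ :=
    hindep.comp (fun i x => b i * x) fun i => by fun_prop
  have hsum := IndepFun.variance_sum (s := Finset.univ) (fun i _ => hL2 i)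
    (fun i _ j _ hij => hind.indepFun hij)
  have hm : ∀ i, ∫ ω, b i * X i ω ∂μ = 0 := fun i => by rw [integral_const_mul, hmean, mul_zero]
  have e : (∑ i, fun ω => b i * X i ω) = fun ω => ∑ i, b i * X i ω := by
    ext ω; simp
  rw [e, variance_of_integral_eq_zero
    (memLp_finsetSum _ fun i _ => hL2 i).aestronglyMeasurable.aemeasurable (by
      rw [integral_finsetSum _ fun i _ => (hL2 i).integrable (by norm_num)]
      simp [hm])] at hsum
  rw [hsum, Finset.mul_sum]
  refine Finset.sum_congr rfl fun i _ => ?_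
  rw [variance_of_integral_eq_zero (hL2 i).aestronglyMeasurable.aemeasurable (hm i)]
  simp_rw [mul_pow]
  rw [integral_const_mul, hvar, mul_comm]

/-- Weak law of large numbers for the squares, with an explicit rate. -/
lemma measureReal_mean_sq_sub_ge_le [Nonempty ι] {K : ℝ} (hindep : iIndepFun X μ)
    (hX : ∀ i, MemLp (X i) 4 μ)
    (hvar : ∀ i, ∫ ω, X i ω ^ 2 ∂μ = sigma ^ 2) (hfour : ∀ i, ∫ ω, X i ω ^ 4 ∂μ ≤ K)
    {δ : ℝ} (hδ : 0 < δ) :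
    μ.real {ω | δ ≤ |(Fintype.card ι : ℝ)⁻¹ * ∑ i, X i ω ^ 2 - sigma ^ 2|}
      ≤ K / ((Fintype.card ι : ℝ) * δ ^ 2) := by
  have hN : (0 : ℝ) < Fintype.card ι := by exact_mod_cast Fintype.card_pos
  have hL2 : ∀ i, MemLp (fun ω => X i ω ^ 2) 2 μ := fun i => by
    refine (memLp_two_iff_integrable_sq ((hX i).aestronglyMeasurable.pow 2)).2 ?_
    have := integrable_pow_of_memLp_four (hX i) (n := 4) le_rfl
    refine this.congr (Eventually.of_forall fun ω => ?_)
    change X i ω ^ 4 = (X i ω ^ 2) ^ 2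
    ring
  have hind : iIndepFun (fun i ω => X i ω ^ 2) μ :=
    hindep.comp (fun i x => x ^ 2) fun i => by fun_prop
  have hsum := IndepFun.variance_sum (s := Finset.univ) (fun i _ => hL2 i)
    (fun i _ j _ hij => hind.indepFun hij)
  have e : (∑ i, fun ω => X i ω ^ 2) = fun ω => ∑ i, X i ω ^ 2 := by
    ext ω; simp
  rw [e] at hsum
  have hS : MemLp (fun ω => ∑ i, X i ω ^ 2) 2 μ := memLp_finsetSum _ fun i _ => hL2 i
  have hES : ∫ ω, ∑ i, X i ω ^ 2 ∂μ = Fintype.card ι * sigma ^ 2 := by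
    rw [integral_finsetSum _ fun i _ => (hL2 i).integrable (by norm_num)]
    simp [hvar]
  have hVar : Var[fun ω => ∑ i, X i ω ^ 2; μ] ≤ Fintype.card ι * K := by
    rw [hsum]
    calc _ ≤ ∑ _i : ι, K := Finset.sum_le_sum fun i _ => by
          refine (variance_le_expectation_sq (hL2 i).aestronglyMeasurable).trans ?_
          refine le_trans (le_of_eq ?_) (hfour i)
          refine integral_congr_ae (Eventually.of_forall fun ω => ?_)
          simp [← pow_mul]
      _ = _ := by simp
  have hcheb := meas_ge_le_variance_div_sq hS (c := Fintype.card ι * δ) (by positivity)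
  rw [hES] at hcheb
  have hset : {ω | δ ≤ |(Fintype.card ι : ℝ)⁻¹ * ∑ i, X i ω ^ 2 - sigma ^ 2|}
      = {ω | (Fintype.card ι : ℝ) * δ ≤ |∑ i, X i ω ^ 2 - Fintype.card ι * sigma ^ 2|} := by
    ext ω
    have : (Fintype.card ι : ℝ)⁻¹ * ∑ i, X i ω ^ 2 - sigma ^ 2
        = (Fintype.card ι : ℝ)⁻¹ * (∑ i, X i ω ^ 2 - Fintype.card ι * sigma ^ 2) := by
      field_simp
    simp only [Set.mem_ofPred_eq]
    rw [this, abs_mul, abs_of_pos (inv_pos.2 hN), ← div_eq_inv_mul, le_div_iff₀ hN, mul_comm]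
  rw [hset, Measure.real]
  refine (ENNReal.toReal_le_of_le_ofReal
    (div_nonneg (variance_nonneg _ _) (sq_nonneg _)) hcheb).trans ?_
  calc _ ≤ (Fintype.card ι * K) / (Fintype.card ι * δ) ^ 2 := by gcongr
    _ = _ := by field_simp

end SquaredMoments

/-- Central limit theorem with a random normalization: if the characteristic functions of `Z k`
tend to that of the standard Gaussian law, the second moments of `Z k` are at most one and `W k`
tends to one in probability, then `W k * Z k` is asymptotically standard Gaussian. The probability
spaces may vary with `k`. -/
theorem tendstoInDistribution_mul_of_tendsto_charFun {Ω : ℕ → Type*} [∀ k, MeasurableSpace (Ω k)]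
    {μ : (k : ℕ) → Measure (Ω k)} [∀ k, IsProbabilityMeasure (μ k)] {W Z : (k : ℕ) → Ω k → ℝ}
    (hW : ∀ k, AEMeasurable (W k) (μ k)) (hZ : ∀ k, AEMeasurable (Z k) (μ k))
    (hZ2 : ∀ k, Integrable (fun ω => Z k ω ^ 2) (μ k)) (hZ1 : ∀ k, ∫ ω, Z k ω ^ 2 ∂μ k ≤ 1)
    (hchar : ∀ t : ℝ, Tendsto (fun k => charFun ((μ k).map (Z k)) t) atTop
      (𝓝 (Complex.exp (-(t ^ 2 / 2 : ℝ)))))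
    (hW1 : ∀ δ > 0, Tendsto (fun k => (μ k).real {ω | δ ≤ |W k ω - 1|}) atTop (𝓝 0)) :
    TendstoInDistribution (fun k ω => W k ω * Z k ω) atTop (id : ℝ → ℝ) μ (gaussianReal 0 1) := by
  have hclose : ∀ ε > 0,
      ∀ᶠ k in atTop, (μ k).real {ω | ε < |W k ω * Z k ω - Z k ω|} ≤ ε := by
    intro ε hε
    -- The level `L` makes the Chebyshev bound `1 / L ^ 2` for the tail of `Z` equal to `ε / 2`.
    set L : ℝ := √(2 / ε) with hL
    have hL0 : 0 < L := Real.sqrt_pos.2 (by positivity)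
    have hL2 : L ^ 2 = 2 / ε := Real.sq_sqrt (by positivity)
    have hev := (hW1 (ε / L) (by positivity)).eventually_lt_const (half_pos hε)
    filter_upwards [hev] with k hk
    have hsub : {ω | ε < |W k ω * Z k ω - Z k ω|}
        ⊆ {ω | ε / L ≤ |W k ω - 1|} ∪ {ω | L ^ 2 ≤ Z k ω ^ 2} := by
      intro ω hω
      by_contra hcon
      simp only [Set.mem_union, Set.mem_ofPred_eq, not_or, not_le] at hcon hω
      obtain ⟨h1, h2⟩ := hcon
      have h3 : |Z k ω| < L := abs_lt_of_sq_lt_sq h2 hL0.le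
      have h4 : |W k ω * Z k ω - Z k ω| = |W k ω - 1| * |Z k ω| := by
        rw [← abs_mul]; congr 1; ring
      have h5 : |W k ω - 1| * |Z k ω| ≤ ε / L * L :=
        mul_le_mul h1.le h3.le (abs_nonneg _) (by positivity)
      rw [div_mul_cancel₀ _ hL0.ne'] at h5
      linarith
    have hmarkov := mul_meas_ge_le_integral_of_nonneg (μ := μ k)
      (Eventually.of_forall fun ω => sq_nonneg (Z k ω)) (hZ2 k) (L ^ 2)
    have h6 : (μ k).real {ω | L ^ 2 ≤ Z k ω ^ 2} ≤ ε / 2 := by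
      rw [hL2] at hmarkov ⊢
      have := hmarkov.trans (hZ1 k)
      rw [div_mul_eq_mul_div, div_le_iff₀ hε] at this
      linarith
    calc _ ≤ (μ k).real ({ω | ε / L ≤ |W k ω - 1|} ∪ {ω | L ^ 2 ≤ Z k ω ^ 2}) :=
          measureReal_mono hsub
      _ ≤ _ := measureReal_union_le _ _
      _ ≤ ε := by linarith
  refine ⟨fun k => (hW k).mul (hZ k), aemeasurable_id, ?_⟩
  refine ProbabilityMeasure.tendsto_of_tendsto_charFun fun t => ?_
  simp only [ProbabilityMeasure.coe_mk, Measure.map_id]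
  have hg : charFun (gaussianReal 0 1) t = Complex.exp (-(t ^ 2 / 2 : ℝ)) := by
    rw [charFun_gaussianReal]
    congr 1
    push_cast
    simp
  rw [hg]
  have hdiff : Tendsto (fun k => charFun ((μ k).map fun ω => W k ω * Z k ω) t
      - charFun ((μ k).map (Z k)) t) atTop (𝓝 0) := by
    rw [Metric.tendsto_atTop']
    intro η hη
    have hε : 0 < η / (2 * (|t| + 2)) := by positivity
    obtain ⟨N, hN⟩ := eventually_atTop.1 (hclose _ hε)
    refine ⟨N, fun k hk => ?_⟩
    rw [dist_zero_right]
    refine (norm_charFun_mul_sub_le (hW k) (hZ k) t hε.le).trans_lt ?_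
    have := hN k hk.le
    calc |t| * (η / (2 * (|t| + 2)))
          + 2 * (μ k).real {ω | η / (2 * (|t| + 2)) < |W k ω * Z k ω - Z k ω|}
        ≤ |t| * (η / (2 * (|t| + 2))) + 2 * (η / (2 * (|t| + 2))) := by gcongr
      _ = η / 2 := by field_simp
      _ < η := by linarith
  simpa using hdiff.add (hchar t)

/-! ### Least squares with a well conditioned design -/

section LeastSquares

variable {m n : Type*} [Fintype m] [Fintype n] [DecidableEq n]

/-- The least squares matrix `(Xᵀ X)⁻¹ Xᵀ`, which maps responses to fitted coefficients. -/
def lsMatrix (X : Matrix m n ℝ) : Matrix n m ℝ := (Xᵀ * X)⁻¹ * Xᵀ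

/-- The residual maker `1 - X (Xᵀ X)⁻¹ Xᵀ`. -/
def residMatrix [DecidableEq m] (X : Matrix m n ℝ) : Matrix m m ℝ := 1 - X * lsMatrix X

variable {X : Matrix m n ℝ} {c : ℝ}

lemma mul_dotProduct_le_gram (h : (Xᵀ * X - c • (1 : Matrix n n ℝ)).PosSemidef) (y : n → ℝ) :
    c * (y ⬝ᵥ y) ≤ y ⬝ᵥ ((Xᵀ * X) *ᵥ y) := by
  have := h.dotProduct_mulVec_nonneg y
  simp only [star_trivial, sub_mulVec, dotProduct_sub, smul_mulVec, one_mulVec,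
    dotProduct_smul, smul_eq_mul] at this
  linarith

lemma isUnit_det_gram (hc : 0 < c) (h : (Xᵀ * X - c • (1 : Matrix n n ℝ)).PosSemidef) :
    IsUnit (Xᵀ * X).det := by
  rw [isUnit_iff_ne_zero]
  intro h0
  obtain ⟨v, hv, hv0⟩ := exists_mulVec_eq_zero_iff.2 h0
  have := mul_dotProduct_le_gram h v
  rw [hv0, dotProduct_zero] at this
  have h1 : 0 ≤ v ⬝ᵥ v := by simpa using dotProduct_star_self_nonneg v
  have h2 : v ⬝ᵥ v = 0 := by nlinarith
  exact hv (dotProduct_self_eq_zero.1 h2)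

lemma lsMatrix_mul (hG : IsUnit (Xᵀ * X).det) : lsMatrix X * X = 1 := by
  rw [lsMatrix, Matrix.mul_assoc, nonsing_inv_mul _ hG]

lemma lsMatrix_transpose : (lsMatrix X)ᵀ = X * (Xᵀ * X)⁻¹ := by
  rw [lsMatrix, transpose_mul, transpose_nonsing_inv, transpose_mul, transpose_transpose]

lemma lsMatrix_mul_transpose (hG : IsUnit (Xᵀ * X).det) :
    lsMatrix X * (lsMatrix X)ᵀ = (Xᵀ * X)⁻¹ := by
  rw [lsMatrix_transpose, ← Matrix.mul_assoc, lsMatrix_mul hG, Matrix.one_mul]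

lemma hatMatrix_isSymm : (X * lsMatrix X)ᵀ = X * lsMatrix X := by
  rw [transpose_mul, lsMatrix_transpose, lsMatrix, Matrix.mul_assoc]

lemma hatMatrix_mul_self (hG : IsUnit (Xᵀ * X).det) :
    X * lsMatrix X * (X * lsMatrix X) = X * lsMatrix X := by
  rw [Matrix.mul_assoc, ← Matrix.mul_assoc (lsMatrix X) X, lsMatrix_mul hG, Matrix.one_mul]

lemma residMatrix_isSymm [DecidableEq m] : (residMatrix X)ᵀ = residMatrix X := by
  rw [residMatrix, transpose_sub, hatMatrix_isSymm, transpose_one]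

lemma residMatrix_mul [DecidableEq m] (hG : IsUnit (Xᵀ * X).det) : residMatrix X * X = 0 := by
  rw [residMatrix, Matrix.sub_mul, Matrix.one_mul, Matrix.mul_assoc, lsMatrix_mul hG,
    Matrix.mul_one, sub_self]

lemma transpose_mul_residMatrix [DecidableEq m] (hG : IsUnit (Xᵀ * X).det) :
    Xᵀ * residMatrix X = 0 := by
  have := congrArg transpose (residMatrix_mul hG)
  rwa [transpose_mul, residMatrix_isSymm, transpose_zero] at this

/-- Pythagoras for the projection onto the column space and its complement. -/
lemma residMatrix_dotProduct_self [DecidableEq m] (hG : IsUnit (Xᵀ * X).det) (v : m → ℝ) :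
    (residMatrix X *ᵥ v) ⬝ᵥ (residMatrix X *ᵥ v)
      = v ⬝ᵥ v - ((X * lsMatrix X) *ᵥ v) ⬝ᵥ ((X * lsMatrix X) *ᵥ v) := by
  have h1 : ((X * lsMatrix X) *ᵥ v) ⬝ᵥ ((X * lsMatrix X) *ᵥ v)
      = v ⬝ᵥ ((X * lsMatrix X) *ᵥ v) := by
    rw [dotProduct_mulVec, ← mulVec_transpose, hatMatrix_isSymm, mulVec_mulVec,
      hatMatrix_mul_self hG, dotProduct_comm]
  rw [residMatrix, sub_mulVec, one_mulVec, sub_dotProduct, dotProduct_sub, dotProduct_sub, h1,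
    dotProduct_comm ((X * lsMatrix X) *ᵥ v) v]
  ring

lemma residMatrix_dotProduct_self_le [DecidableEq m] (hG : IsUnit (Xᵀ * X).det) (v : m → ℝ) :
    (residMatrix X *ᵥ v) ⬝ᵥ (residMatrix X *ᵥ v) ≤ v ⬝ᵥ v := by
  rw [residMatrix_dotProduct_self hG]
  have : 0 ≤ ((X * lsMatrix X) *ᵥ v) ⬝ᵥ ((X * lsMatrix X) *ᵥ v) := by
    simpa using dotProduct_star_self_nonneg ((X * lsMatrix X) *ᵥ v)
  linarith

lemma mul_inv_gram_dotProduct_self_le (hc : 0 < c)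
    (h : (Xᵀ * X - c • (1 : Matrix n n ℝ)).PosSemidef) (a : n → ℝ) :
    c * (((Xᵀ * X)⁻¹ *ᵥ a) ⬝ᵥ ((Xᵀ * X)⁻¹ *ᵥ a)) ≤ a ⬝ᵥ ((Xᵀ * X)⁻¹ *ᵥ a) := by
  have h1 := mul_dotProduct_le_gram h ((Xᵀ * X)⁻¹ *ᵥ a)
  rwa [mulVec_mulVec, mul_nonsing_inv _ (isUnit_det_gram hc h), one_mulVec,
    dotProduct_comm _ a] at h1

lemma inv_gram_quadratic_pos (hc : 0 < c) (h : (Xᵀ * X - c • (1 : Matrix n n ℝ)).PosSemidef)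
    {a : n → ℝ} (ha : a ≠ 0) : 0 < a ⬝ᵥ ((Xᵀ * X)⁻¹ *ᵥ a) := by
  refine lt_of_lt_of_le (mul_pos hc ?_) (mul_inv_gram_dotProduct_self_le hc h a)
  refine lt_of_le_of_ne (by simpa using dotProduct_star_self_nonneg ((Xᵀ * X)⁻¹ *ᵥ a)) ?_
  intro h0
  have h1 := dotProduct_self_eq_zero.1 h0.symm
  have h2 : (Xᵀ * X) *ᵥ ((Xᵀ * X)⁻¹ *ᵥ a) = a := by
    rw [mulVec_mulVec, mul_nonsing_inv _ (isUnit_det_gram hc h), one_mulVec]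
  rw [h1, mulVec_zero] at h2
  exact ha h2.symm

lemma mul_inv_gram_quadratic_le (hc : 0 < c) (h : (Xᵀ * X - c • (1 : Matrix n n ℝ)).PosSemidef)
    (a : n → ℝ) : c * (a ⬝ᵥ ((Xᵀ * X)⁻¹ *ᵥ a)) ≤ a ⬝ᵥ a := by
  set y := (Xᵀ * X)⁻¹ *ᵥ a with hy
  have h1 : c * (y ⬝ᵥ y) ≤ a ⬝ᵥ y := mul_inv_gram_dotProduct_self_le hc h a
  have h2 : 0 ≤ (c • y - a) ⬝ᵥ (c • y - a) := by
    simpa using dotProduct_star_self_nonneg (c • y - a)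
  simp only [sub_dotProduct, dotProduct_sub, smul_dotProduct, dotProduct_smul, smul_eq_mul] at h2
  rw [dotProduct_comm y a] at h2
  nlinarith

lemma sum_sq_lsMatrix_transpose_mulVec (hG : IsUnit (Xᵀ * X).det) (a : n → ℝ) :
    ∑ r, ((lsMatrix X)ᵀ *ᵥ a) r ^ 2 = a ⬝ᵥ ((Xᵀ * X)⁻¹ *ᵥ a) := by
  rw [← lsMatrix_mul_transpose hG, ← mulVec_mulVec, dotProduct_mulVec, ← mulVec_transpose]
  simp [dotProduct, sq]

/-- The leverage bound: no single observation carries a large share of a linear contrast. -/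
lemma sq_lsMatrix_transpose_mulVec_le (hc : 0 < c)
    (h : (Xᵀ * X - c • (1 : Matrix n n ℝ)).PosSemidef) {ρ : ℝ} {r : m}
    (hrow : ∑ s, X r s ^ 2 ≤ ρ) (a : n → ℝ) :
    ((lsMatrix X)ᵀ *ᵥ a) r ^ 2 ≤ ρ / c * (a ⬝ᵥ ((Xᵀ * X)⁻¹ *ᵥ a)) := by
  have h1 : ((lsMatrix X)ᵀ *ᵥ a) r = ∑ s, X r s * ((Xᵀ * X)⁻¹ *ᵥ a) s := by
    rw [lsMatrix_transpose, ← mulVec_mulVec]; rfl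
  have h2 := mul_inv_gram_dotProduct_self_le hc h a
  set y := (Xᵀ * X)⁻¹ *ᵥ a
  have h3 : y ⬝ᵥ y = ∑ s, y s ^ 2 := by simp [dotProduct, sq]
  rw [h3] at h2
  have h4 : 0 ≤ ∑ s, y s ^ 2 := Finset.sum_nonneg fun s _ => sq_nonneg _
  have hρ : 0 ≤ ρ := (Finset.sum_nonneg fun s _ => sq_nonneg _).trans hrow
  rw [h1]
  calc _ ≤ (∑ s, X r s ^ 2) * ∑ s, y s ^ 2 := Finset.sum_mul_sq_le_sq_mul_sq _ _ _
    _ ≤ ρ * ((a ⬝ᵥ y) / c) := by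
        refine mul_le_mul hrow ?_ h4 hρ
        rw [le_div_iff₀ hc]; linarith
    _ = _ := by ring

lemma sum_sq_eq_trace {m n : Type*} [Fintype m] [Fintype n] (A : Matrix n m ℝ) :
    ∑ s, ∑ r, A s r ^ 2 = (A * Aᵀ).trace := by
  simp [Matrix.trace, Matrix.mul_apply, sq]

lemma mul_sum_sq_lsMatrix_le (hc : 0 < c) (h : (Xᵀ * X - c • (1 : Matrix n n ℝ)).PosSemidef) :
    c * ∑ s, ∑ r, lsMatrix X s r ^ 2 ≤ Fintype.card n := by
  rw [sum_sq_eq_trace, lsMatrix_mul_transpose (isUnit_det_gram hc h), Matrix.trace,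
    Finset.mul_sum]
  calc _ ≤ ∑ _s : n, (1 : ℝ) := Finset.sum_le_sum fun s _ => by
        have := mul_inv_gram_quadratic_le hc h (Pi.single s 1)
        simpa using this
    _ = _ := by simp

lemma sum_sq_hatMatrix (hG : IsUnit (Xᵀ * X).det) :
    ∑ r, ∑ r', (X * lsMatrix X) r r' ^ 2 = Fintype.card n := by
  rw [sum_sq_eq_trace, hatMatrix_isSymm, hatMatrix_mul_self hG, trace_mul_comm, lsMatrix_mul hG,
    trace_one]

lemma card_mul_le_sum_sq (h : (Xᵀ * X - c • (1 : Matrix n n ℝ)).PosSemidef) :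
    Fintype.card n * c ≤ ∑ r, ∑ s, X r s ^ 2 := by
  have h1 := h.trace_nonneg
  rw [trace_sub, trace_smul, trace_one, trace_mul_comm, ← sum_sq_eq_trace] at h1
  simp only [smul_eq_mul] at h1
  linarith

end LeastSquares

/-! ### Penalties and fusion inequalities -/

/-- Near zero the penalty has at least half its slope at the origin. No continuity at zero is
needed. -/
lemma IsConcavePenalty.exists_half_slope_le {a : ℝ} {pen : ℝ → ℝ → ℝ} (h : IsConcavePenalty a pen)
    {lam : ℝ} (hlam : 0 < lam) :
    ∃ δ > 0, ∀ t, 0 ≤ t → t < δ → lam / 2 * t ≤ pen lam t := by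
  have hev := (h.deriv_zero lam hlam).eventually (lt_mem_nhds (by norm_num : (1 / 2 : ℝ) < 1))
  obtain ⟨δ, hδ, hsub⟩ := mem_nhdsGT_iff_exists_Ioo_subset.1 hev
  refine ⟨δ, hδ, fun t ht0 htδ => ?_⟩
  rcases ht0.eq_or_lt with rfl | ht
  · simp [h.zero lam hlam]
  have h1 : 1 / 2 < lam⁻¹ * deriv (pen lam) t := hsub ⟨ht, htδ⟩
  rw [← div_eq_inv_mul, lt_div_iff₀ hlam] at h1
  have hd : DifferentiableAt ℝ (pen lam) t :=
    (h.diff lam hlam).differentiableAt (Ioi_mem_nhds ht)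
  -- By concavity the chord from the origin is at least as steep as the tangent at `t`.
  have h2 := (h.concave lam hlam).deriv_le_slope (x := 0) (y := t) (by simp) ht0 ht hd
  rw [slope_def_field, h.zero lam hlam, sub_zero, sub_zero, le_div_iff₀ ht] at h2
  nlinarith

/-- A linear form in the deviations from a common value splits into a fusion part, controlled by
the pairwise differences, and a part that only sees the sum of the coefficients. -/
lemma sum_inner_le_of_group {κ V : Type*} [NormedAddCommGroup V] [InnerProductSpace ℝ V]
    (G : Finset κ) (hG : G.Nonempty) (g Δ : κ → V) {B H : ℝ} (hB : ∀ m ∈ G, ‖g m‖ ≤ B)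
    (hH : ‖∑ m ∈ G, g m‖ ≤ H) :
    ∑ m ∈ G, inner ℝ (g m) (Δ m)
      ≤ (G.card : ℝ)⁻¹ * (B * ∑ m ∈ G, ∑ m' ∈ G, ‖Δ m - Δ m'‖ + H * ∑ m ∈ G, ‖Δ m‖) := by
  have hc : (0 : ℝ) < G.card := by exact_mod_cast hG.card_pos
  have key : (G.card : ℝ) * ∑ m ∈ G, inner ℝ (g m) (Δ m)
      = ∑ m ∈ G, ∑ m' ∈ G, inner ℝ (g m) (Δ m - Δ m')
        + inner ℝ (∑ m ∈ G, g m) (∑ m' ∈ G, Δ m') := by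
    rw [sum_inner, ← Finset.sum_add_distrib, Finset.mul_sum]
    refine Finset.sum_congr rfl fun m _ => ?_
    rw [← inner_sum, ← inner_add_right, Finset.sum_sub_distrib]
    simp [inner_smul_right, ← Nat.cast_smul_eq_nsmul ℝ]
  rw [← div_eq_inv_mul, le_div_iff₀ hc, mul_comm, key]
  refine add_le_add ?_ ?_
  · rw [Finset.mul_sum]
    refine Finset.sum_le_sum fun m hm => ?_
    rw [Finset.mul_sum]
    refine Finset.sum_le_sum fun m' _ => (real_inner_le_norm _ _).trans ?_
    exact mul_le_mul_of_nonneg_right (hB m hm) (norm_nonneg _)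
  · refine (real_inner_le_norm _ _).trans ?_
    exact mul_le_mul hH (norm_sum_le _ _) (norm_nonneg _) ((norm_nonneg _).trans hH)

lemma sum_sum_le_two_mul_sum_Ici {n : ℕ} (f : Fin n → Fin n → ℝ) (hf : ∀ i j, 0 ≤ f i j)
    (hsymm : ∀ i j, f i j = f j i) :
    ∑ i, ∑ j, f i j ≤ 2 * ∑ i, ∑ j ∈ Finset.Ici i, f i j := by
  have h1 : ∀ i, ∑ j, f i j ≤ ∑ j ∈ Finset.Ici i, f i j + ∑ j ∈ Finset.Iic i, f i j := fun i => by
    have hu : (Finset.univ : Finset (Fin n)) = Finset.Ici i ∪ Finset.Iic i := by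
      ext j; simpa using le_total i j
    rw [hu, ← Finset.sum_union_inter]
    exact le_add_of_nonneg_right (Finset.sum_nonneg fun j _ => hf i j)
  have h2 : ∑ i, ∑ j ∈ Finset.Iic i, f i j = ∑ i, ∑ j ∈ Finset.Ici i, f i j := by
    rw [Finset.sum_comm' (t' := Finset.univ) (s' := fun j => Finset.Ici j) (by simp)]
    exact Finset.sum_congr rfl fun i _ => Finset.sum_congr rfl fun j _ => hsymm _ _
  calc _ ≤ ∑ i, (∑ j ∈ Finset.Ici i, f i j + ∑ j ∈ Finset.Iic i, f i j) :=
        Finset.sum_le_sum fun i _ => h1 i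
    _ = _ := by rw [Finset.sum_add_distrib, h2]; ring

namespace Federation

variable (D : Federation)

/-! ### The oracle least squares estimator -/

/-- Least squares coefficients of the nonzero groups. -/
def oracleCoef (Y : D.Resp) (s : D.Nonzero) : EuclideanSpace ℝ (Fin D.q) :=
  ∑ r, lsMatrix D.design₁ s r • Y r

/-- The oracle estimator in closed form. -/
def oracle (Y : D.Resp) : D.Params := D.ofNonzero (D.oracleCoef Y)

/-- The residuals of the oracle estimator. -/
def resid (Y : D.Resp) : D.Resp := fun r => Y r - D.fit (D.oracle Y) r

/-- The block `X_{m(j)}ᵀ R_m` of the score, with `R` the oracle residuals. -/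
def score (Y : D.Resp) (m : Fin D.M) (j : Fin D.p) : EuclideanSpace ℝ (Fin D.q) :=
  ∑ i, D.X ⟨m, i⟩ j • D.resid Y ⟨m, i⟩

variable {D}

lemma members_nonempty (s : D.Group) : (D.members s).Nonempty := by
  obtain ⟨m, hm⟩ := D.grp_surj s.1 s.2
  exact ⟨m, by simp [members, hm]⟩

lemma fit_ofNonzero (Phi : D.Nonzero → EuclideanSpace ℝ (Fin D.q)) (r : D.Obs) :
    D.fit (D.ofNonzero Phi) r = ∑ s, D.design₁ r s • Phi s := by
  classical
  have h1 : ∑ s, D.design₁ r s • Phi s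
      = ∑ s : D.Group, if h : D.Phi0 s ≠ 0 then D.design r s • Phi ⟨s, h⟩ else 0 := by
    rw [← Fintype.sum_subtype_add_sum_subtype (fun s : D.Group => D.Phi0 s ≠ 0)]
    rw [Finset.sum_eq_zero (s := (Finset.univ : Finset {s : D.Group // ¬ D.Phi0 s ≠ 0}))
      (fun s _ => dif_neg s.2), add_zero]
    refine Finset.sum_congr (by ext; simp) fun s _ => ?_
    rw [dif_pos s.2]
    rfl
  rw [h1, Fintype.sum_sigma, fit]
  refine Finset.sum_congr rfl fun j _ => ?_
  rw [Finset.sum_eq_single (D.grp j r.1)]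
  · simp only [ofNonzero, design, if_true]
    split_ifs <;> simp
  · intro t _ ht
    simp [design, ht.symm]
  · simp

lemma ofNonzero_apply_of_ne {Phi : D.Nonzero → EuclideanSpace ℝ (Fin D.q)} {m : Fin D.M}
    {j : Fin D.p} (h : D.Phi0 ⟨j, D.grp j m⟩ ≠ 0) :
    D.ofNonzero Phi m j = Phi ⟨⟨j, D.grp j m⟩, h⟩ := by
  simp [ofNonzero, h]

lemma ofNonzero_apply_of_eq {Phi : D.Nonzero → EuclideanSpace ℝ (Fin D.q)} {m : Fin D.M}
    {j : Fin D.p} (h : D.Phi0 ⟨j, D.grp j m⟩ = 0) : D.ofNonzero Phi m j = 0 := by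
  simp [ofNonzero, h]

lemma ofNonzero_congr_group {Phi : D.Nonzero → EuclideanSpace ℝ (Fin D.q)} {m m' : Fin D.M}
    {j : Fin D.p} (h : D.grp j m = D.grp j m') : D.ofNonzero Phi m j = D.ofNonzero Phi m' j := by
  simp only [ofNonzero, h]

lemma Theta0_eq_ofNonzero : D.Theta0 = D.ofNonzero fun s => D.Phi0 s.1 := by
  ext m j : 2
  by_cases h : D.Phi0 ⟨j, D.grp j m⟩ = 0
  · rw [ofNonzero_apply_of_eq h, Theta0, h]
  · rw [ofNonzero_apply_of_ne h, Theta0]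

lemma groupCoef_ofNonzero (Phi : D.Nonzero → EuclideanSpace ℝ (Fin D.q)) (s : D.Nonzero) :
    D.groupCoef (D.ofNonzero Phi) s.1 = Phi s := by
  obtain ⟨⟨j, t⟩, hs⟩ := s
  have h1 : ∀ m ∈ D.members ⟨j, t⟩, D.ofNonzero Phi m j = Phi ⟨⟨j, t⟩, hs⟩ := fun m hm => by
    have hm' : D.grp j m = t := by simpa [members] using hm
    subst hm'
    exact ofNonzero_apply_of_ne hs
  have hc : ((D.members ⟨j, t⟩).card : ℝ) ≠ 0 := by
    exact_mod_cast (members_nonempty (D := D) ⟨j, t⟩).card_pos.ne'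
  rw [groupCoef, Finset.sum_congr rfl h1, Finset.sum_const, ← Nat.cast_smul_eq_nsmul ℝ, smul_smul,
    inv_mul_cancel₀ hc, one_smul]

lemma fit_sub (A B : D.Params) (r : D.Obs) : D.fit (A - B) r = D.fit A r - D.fit B r := by
  simp [fit, smul_sub]

/-- The column `l` of an `n × q` matrix. -/
def col (Y : D.Resp) (l : Fin D.q) : D.Obs → ℝ := fun r => Y r l

lemma oracleCoef_apply (Y : D.Resp) (s : D.Nonzero) (l : Fin D.q) :
    D.oracleCoef Y s l = (lsMatrix D.design₁ *ᵥ col Y l) s := by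
  simp [oracleCoef, mulVec, dotProduct, col]

lemma sub_fit_ofNonzero_apply (Y : D.Resp) (Phi : D.Nonzero → EuclideanSpace ℝ (Fin D.q))
    (r : D.Obs) (l : Fin D.q) :
    (Y r - ∑ s, D.design₁ r s • Phi s) l
      = (col Y l - D.design₁ *ᵥ fun s => Phi s l) r := by
  simp [mulVec, dotProduct, col]

lemma resid_apply (Y : D.Resp) (r : D.Obs) (l : Fin D.q) :
    D.resid Y r l = (residMatrix D.design₁ *ᵥ col Y l) r := by
  rw [resid, oracle, fit_ofNonzero, sub_fit_ofNonzero_apply, residMatrix, sub_mulVec, one_mulVec,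
    ← mulVec_mulVec]
  simp only [oracleCoef_apply]

lemma sum_norm_sq_eq (R : D.Resp) : ∑ r, ‖R r‖ ^ 2 = ∑ l, col R l ⬝ᵥ col R l := by
  simp_rw [EuclideanSpace.norm_sq_eq, Real.norm_eq_abs, sq_abs, dotProduct, col, ← sq]
  exact Finset.sum_comm

lemma isOracle_oracle (hG : IsUnit (D.design₁ᵀ * D.design₁).det) (Y : D.Resp) :
    D.IsOracle Y (D.oracle Y) := by
  refine ⟨D.oracleCoef Y, rfl, fun Psi => ?_⟩
  refine mul_le_mul_of_nonneg_left ?_ (by positivity)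
  rw [sum_norm_sq_eq, sum_norm_sq_eq]
  refine Finset.sum_le_sum fun l _ => ?_
  set v : D.Obs → ℝ := col Y l - D.design₁ *ᵥ fun s => Psi s l with hv
  have h1 : col (fun r => Y r - ∑ s, D.design₁ r s • D.oracleCoef Y s) l
      = residMatrix D.design₁ *ᵥ v := by
    rw [hv, mulVec_sub, mulVec_mulVec, residMatrix_mul hG, zero_mulVec, sub_zero]
    ext r
    rw [← resid_apply, resid, oracle, fit_ofNonzero]
    rfl
  have h2 : col (fun r => Y r - ∑ s, D.design₁ r s • Psi s) l = v := by
    ext r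
    exact sub_fit_ofNonzero_apply Y Psi r l
  rw [h1, h2]
  exact residMatrix_dotProduct_self_le hG v

lemma col_response (E : D.Resp) (l : Fin D.q) :
    col (D.response E) l = (D.design₁ *ᵥ fun s => D.Phi0 s.1 l) + col E l := by
  ext r
  simp [col, response, Theta0_eq_ofNonzero, fit_ofNonzero, mulVec, dotProduct]

lemma oracleCoef_response_apply (hG : IsUnit (D.design₁ᵀ * D.design₁).det) (E : D.Resp)
    (s : D.Nonzero) (l : Fin D.q) :
    D.oracleCoef (D.response E) s l = D.Phi0 s.1 l + (lsMatrix D.design₁ *ᵥ col E l) s := by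
  rw [oracleCoef_apply, col_response, mulVec_add, mulVec_mulVec, lsMatrix_mul hG, one_mulVec]
  rfl

lemma resid_response_apply (hG : IsUnit (D.design₁ᵀ * D.design₁).det) (E : D.Resp)
    (r : D.Obs) (l : Fin D.q) :
    D.resid (D.response E) r l = (residMatrix D.design₁ *ᵥ col E l) r := by
  rw [resid_apply, col_response, mulVec_add, mulVec_mulVec, residMatrix_mul hG, zero_mulVec,
    zero_add]

lemma sum_members_score (Y : D.Resp) (s : D.Group) :
    ∑ m ∈ D.members s, D.score Y m s.1 = ∑ r, D.design r s • D.resid Y r := by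
  rw [Fintype.sum_sigma, members, Finset.sum_filter]
  refine Finset.sum_congr rfl fun m _ => ?_
  by_cases h : D.grp s.1 m = s.2 <;> simp [score, design, h]

/-- Normal equations of the oracle fit. -/
lemma sum_design_smul_resid (hG : IsUnit (D.design₁ᵀ * D.design₁).det) (Y : D.Resp)
    (s : D.Nonzero) : ∑ r, D.design r s.1 • D.resid Y r = 0 := by
  ext l
  have h : (D.design₁ᵀ *ᵥ (residMatrix D.design₁ *ᵥ col Y l)) s = 0 := by
    rw [mulVec_mulVec, transpose_mul_residMatrix hG, zero_mulVec]; rfl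
  refine Eq.trans ?_ h
  simp [resid_apply, design₁, mulVec, dotProduct]

end Federation

namespace Federation

variable {D : Federation}

/-! ### Local minimality of the oracle estimator -/

lemma sum_inner_resid_fit (Y : D.Resp) (Dl : D.Params) :
    ∑ r, inner ℝ (D.resid Y r) (D.fit Dl r) = ∑ j, ∑ m, inner ℝ (D.score Y m j) (Dl m j) := by
  simp_rw [fit, inner_sum, inner_smul_right]
  rw [Finset.sum_comm]
  refine Finset.sum_congr rfl fun j _ => ?_
  rw [Fintype.sum_sigma]
  refine Finset.sum_congr rfl fun m _ => ?_
  rw [score, sum_inner]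
  exact Finset.sum_congr rfl fun i _ => by rw [real_inner_smul_left]

/-- The linear part of the loss is dominated by the slopes of the penalties, covariate by
covariate. -/
lemma sum_inner_score_le (hG : IsUnit (D.design₁ᵀ * D.design₁).det) (Y : D.Resp)
    {lam₁ lam₂ : ℝ}
    (hzero : ∀ s : D.Group, D.Phi0 s = 0 →
      ‖∑ r, D.design r s • D.resid Y r‖ ≤ D.M * (D.members s).card * (lam₁ / 2))
    (hscore : ∀ m j, ‖D.score Y m j‖
      ≤ D.M * (D.members ⟨j, D.grp j m⟩).card * (lam₂ / 4))
    (Dl : D.Params) (j : Fin D.p) :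
    ∑ m, inner ℝ (D.score Y m j) (Dl m j)
      ≤ D.M * (∑ m, (if D.Phi0 ⟨j, D.grp j m⟩ = 0 then lam₁ / 2 * ‖Dl m j‖ else 0)
        + ∑ m, ∑ m', if D.grp j m = D.grp j m' then lam₂ / 4 * ‖Dl m j - Dl m' j‖ else 0) := by
  rw [← Finset.sum_add_distrib, ← Finset.sum_fiberwise Finset.univ (D.grp j),
    ← Finset.sum_fiberwise Finset.univ (D.grp j)
      (fun m => (if D.Phi0 ⟨j, D.grp j m⟩ = 0 then lam₁ / 2 * ‖Dl m j‖ else 0)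
        + ∑ m', if D.grp j m = D.grp j m' then lam₂ / 4 * ‖Dl m j - Dl m' j‖ else 0),
    Finset.mul_sum]
  refine Finset.sum_le_sum fun t _ => ?_
  set G : Finset (Fin D.M) := D.members ⟨j, t⟩ with hGdef
  have hGne : G.Nonempty := members_nonempty _
  have hc : (0 : ℝ) < G.card := by exact_mod_cast hGne.card_pos
  have hmem : ∀ m ∈ G, D.grp j m = t := fun m hm => by simpa [hGdef, members] using hm
  have hB : ∀ m ∈ G, ‖D.score Y m j‖ ≤ D.M * G.card * (lam₂ / 4) := fun m hm => by
    have := hscore m j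
    rwa [hmem m hm] at this
  have hH : ‖∑ m ∈ G, D.score Y m j‖
      ≤ D.M * G.card * (if D.Phi0 ⟨j, t⟩ = 0 then lam₁ / 2 else 0) := by
    have h1 := sum_members_score Y ⟨j, t⟩
    simp only at h1
    rw [hGdef, h1]
    split_ifs with h
    · exact hzero _ h
    · rw [sum_design_smul_resid hG Y ⟨⟨j, t⟩, h⟩]; simp
  have key := sum_inner_le_of_group G hGne (fun m => D.score Y m j) (fun m => Dl m j) hB hH
  refine key.trans (le_of_eq ?_)
  have e1 : ∑ m ∈ G, ((if D.Phi0 ⟨j, D.grp j m⟩ = 0 then lam₁ / 2 * ‖Dl m j‖ else 0)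
        + ∑ m', if D.grp j m = D.grp j m' then lam₂ / 4 * ‖Dl m j - Dl m' j‖ else 0)
      = (if D.Phi0 ⟨j, t⟩ = 0 then lam₁ / 2 else 0) * ∑ m ∈ G, ‖Dl m j‖
        + lam₂ / 4 * ∑ m ∈ G, ∑ m' ∈ G, ‖Dl m j - Dl m' j‖ := by
    rw [Finset.sum_add_distrib, Finset.mul_sum, Finset.mul_sum]
    congr 1
    · refine Finset.sum_congr rfl fun m hm => ?_
      rw [hmem m hm]
      split_ifs <;> simp
    · refine Finset.sum_congr rfl fun m hm => ?_
      rw [hmem m hm, Finset.mul_sum, hGdef, members, Finset.sum_filter]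
      simp only [eq_comm]
  change _ = (D.M : ℝ) * ∑ m ∈ G, _
  rw [e1]
  field_simp
  ring

/-- If the nonzero rows and the differences across groups of the oracle estimator lie where the
penalties are flat, and if its score is small on the zero groups and for every client, then the
oracle estimator is a local minimizer of the objective. -/
theorem isLocalMin_oracle {a : ℝ} {pen₁ pen₂ : ℝ → ℝ → ℝ}
    (hpen₁ : IsConcavePenalty a pen₁) (hpen₂ : IsConcavePenalty a pen₂) {lam₁ lam₂ : ℝ}
    (hlam₁ : 0 < lam₁) (hlam₂ : 0 < lam₂) (hG : IsUnit (D.design₁ᵀ * D.design₁).det) (Y : D.Resp)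
    (hsig : ∀ m j, D.Phi0 ⟨j, D.grp j m⟩ ≠ 0 → a * lam₁ < ‖D.oracle Y m j‖)
    (hgap : ∀ m m' j, D.grp j m ≠ D.grp j m' → a * lam₂ < ‖D.oracle Y m j - D.oracle Y m' j‖)
    (hzero : ∀ s : D.Group, D.Phi0 s = 0 →
      ‖∑ r, D.design r s • D.resid Y r‖ ≤ D.M * (D.members s).card * (lam₁ / 2))
    (hscore : ∀ m j, ‖D.score Y m j‖
      ≤ D.M * (D.members ⟨j, D.grp j m⟩).card * (lam₂ / 4)) :
    IsLocalMin (D.objective pen₁ pen₂ lam₁ lam₂ Y) (D.oracle Y) := by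
  obtain ⟨δ₁, hδ₁, hp₁⟩ := hpen₁.exists_half_slope_le hlam₁
  obtain ⟨δ₂, hδ₂, hp₂⟩ := hpen₂.exists_half_slope_le hlam₂
  set O := D.oracle Y with hO
  have hM : (0 : ℝ) < D.M := by exact_mod_cast D.M_pos
  have evA : ∀ᶠ Th in 𝓝 O, ∀ m j, ‖Th m j - O m j‖ < δ₁ := by
    refine eventually_all.2 fun m => eventually_all.2 fun j => ?_
    have : Continuous fun Th : D.Params => ‖Th m j - O m j‖ := by fun_prop
    exact this.continuousAt.eventually_lt_const (by simpa using hδ₁)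
  have evB : ∀ᶠ Th in 𝓝 O, ∀ m m' j, ‖(Th m j - O m j) - (Th m' j - O m' j)‖ < δ₂ := by
    refine eventually_all.2 fun m => eventually_all.2 fun m' => eventually_all.2 fun j => ?_
    have : Continuous fun Th : D.Params => ‖(Th m j - O m j) - (Th m' j - O m' j)‖ := by fun_prop
    exact this.continuousAt.eventually_lt_const (by simpa using hδ₂)
  have evC : ∀ᶠ Th in 𝓝 O, ∀ m j, D.Phi0 ⟨j, D.grp j m⟩ ≠ 0 → a * lam₁ < ‖Th m j‖ := by
    refine eventually_all.2 fun m => eventually_all.2 fun j => eventually_imp_distrib_left.2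
      fun h => ?_
    have : Continuous fun Th : D.Params => ‖Th m j‖ := by fun_prop
    exact this.continuousAt.eventually_const_lt (hsig m j h)
  have evD : ∀ᶠ Th in 𝓝 O, ∀ m m' j, D.grp j m ≠ D.grp j m' → a * lam₂ < ‖Th m j - Th m' j‖ := by
    refine eventually_all.2 fun m => eventually_all.2 fun m' => eventually_all.2 fun j =>
      eventually_imp_distrib_left.2 fun h => ?_
    have : Continuous fun Th : D.Params => ‖Th m j - Th m' j‖ := by fun_prop
    exact this.continuousAt.eventually_const_lt (hgap m m' j h)
  filter_upwards [evA, evB, evC, evD] with Th hA hB hC hDd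
  set Dl : D.Params := Th - O with hDl
  have hDlapp : ∀ m j, Dl m j = Th m j - O m j := fun _ _ => rfl
  -- The quadratic loss, linearized at the oracle.
  have hquad : ∑ r, ‖Y r - D.fit O r‖ ^ 2 - 2 * ∑ j, ∑ m, inner ℝ (D.score Y m j) (Dl m j)
      ≤ ∑ r, ‖Y r - D.fit Th r‖ ^ 2 := by
    rw [← sum_inner_resid_fit, Finset.mul_sum, ← Finset.sum_sub_distrib]
    refine Finset.sum_le_sum fun r _ => ?_
    have h1 : Y r - D.fit Th r = D.resid Y r - D.fit Dl r := by
      rw [hDl, fit_sub, resid]; abel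
    have h2 := norm_sub_sq_real (D.resid Y r) (D.fit Dl r)
    have h3 := sq_nonneg ‖D.fit Dl r‖
    rw [h1]
    change ‖D.resid Y r‖ ^ 2 - _ ≤ _
    linarith
  have hpen1 : ∀ j m, pen₁ lam₁ ‖O m j‖
      + (if D.Phi0 ⟨j, D.grp j m⟩ = 0 then lam₁ / 2 * ‖Dl m j‖ else 0) ≤ pen₁ lam₁ ‖Th m j‖ := by
    intro j m
    split_ifs with h
    · have h0 : O m j = 0 := ofNonzero_apply_of_eq h
      have hT : Dl m j = Th m j := by rw [hDlapp, h0, sub_zero]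
      rw [h0, norm_zero, hpen₁.zero lam₁ hlam₁, zero_add, hT]
      refine hp₁ _ (norm_nonneg _) ?_
      simpa [h0] using hA m j
    · rw [hpen₁.const lam₁ hlam₁ _ (hsig m j h).le, hpen₁.const lam₁ hlam₁ _ (hC m j h).le,
        add_zero]
  have hpen2 : ∀ j m m', pen₂ lam₂ ‖O m j - O m' j‖
      + (if D.grp j m = D.grp j m' then lam₂ / 2 * ‖Dl m j - Dl m' j‖ else 0)
      ≤ pen₂ lam₂ ‖Th m j - Th m' j‖ := by
    intro j m m'
    split_ifs with h
    · have h0 : O m j = O m' j := ofNonzero_congr_group h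
      have hT : Dl m j - Dl m' j = Th m j - Th m' j := by
        rw [hDlapp, hDlapp, h0]; abel
      rw [h0, sub_self, norm_zero, hpen₂.zero lam₂ hlam₂, zero_add, hT]
      refine hp₂ _ (norm_nonneg _) ?_
      have := hB m m' j
      rwa [← hDlapp, ← hDlapp, hT] at this
    · rw [hpen₂.const lam₂ hlam₂ _ (hgap m m' j h).le, hpen₂.const lam₂ hlam₂ _ (hDd m m' j h).le,
        add_zero]
  have hlin : ∑ j, ∑ m, inner ℝ (D.score Y m j) (Dl m j)
      ≤ D.M * ∑ j, (∑ m, (if D.Phi0 ⟨j, D.grp j m⟩ = 0 then lam₁ / 2 * ‖Dl m j‖ else 0)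
        + ∑ m, ∑ m' ∈ Finset.Ici m,
            if D.grp j m = D.grp j m' then lam₂ / 2 * ‖Dl m j - Dl m' j‖ else 0) := by
    rw [Finset.mul_sum]
    refine Finset.sum_le_sum fun j _ => (sum_inner_score_le hG Y hzero hscore Dl j).trans ?_
    refine mul_le_mul_of_nonneg_left (add_le_add le_rfl ?_) hM.le
    refine (sum_sum_le_two_mul_sum_Ici _ (fun m m' => ?_) (fun m m' => ?_)).trans (le_of_eq ?_)
    · split_ifs <;> positivity
    · rw [norm_sub_rev]; simp only [eq_comm]
    · rw [Finset.mul_sum]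
      refine Finset.sum_congr rfl fun m _ => ?_
      rw [Finset.mul_sum]
      refine Finset.sum_congr rfl fun m' _ => ?_
      split_ifs <;> ring
  have hs1 : ∑ j, ∑ m, pen₁ lam₁ ‖O m j‖
      + ∑ j, ∑ m, (if D.Phi0 ⟨j, D.grp j m⟩ = 0 then lam₁ / 2 * ‖Dl m j‖ else 0)
      ≤ ∑ j, ∑ m, pen₁ lam₁ ‖Th m j‖ := by
    simp_rw [← Finset.sum_add_distrib]
    exact Finset.sum_le_sum fun j _ => Finset.sum_le_sum fun m _ => hpen1 j m
  have hs2 : ∑ j, ∑ m, ∑ m' ∈ Finset.Ici m, pen₂ lam₂ ‖O m j - O m' j‖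
      + ∑ j, ∑ m, ∑ m' ∈ Finset.Ici m,
          (if D.grp j m = D.grp j m' then lam₂ / 2 * ‖Dl m j - Dl m' j‖ else 0)
      ≤ ∑ j, ∑ m, ∑ m' ∈ Finset.Ici m, pen₂ lam₂ ‖Th m j - Th m' j‖ := by
    simp_rw [← Finset.sum_add_distrib]
    exact Finset.sum_le_sum fun j _ => Finset.sum_le_sum fun m _ =>
      Finset.sum_le_sum fun m' _ => hpen2 j m m'
  rw [Finset.sum_add_distrib] at hlin
  have hq2 : (2 * (D.M : ℝ))⁻¹ * (∑ r, ‖Y r - D.fit O r‖ ^ 2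
        - 2 * ∑ j, ∑ m, inner ℝ (D.score Y m j) (Dl m j))
      ≤ (2 * (D.M : ℝ))⁻¹ * ∑ r, ‖Y r - D.fit Th r‖ ^ 2 :=
    mul_le_mul_of_nonneg_left hquad (by positivity)
  have hl2 := mul_le_mul_of_nonneg_left hlin (inv_nonneg.2 hM.le)
  rw [inv_mul_cancel_left₀ hM.ne'] at hl2
  have hexp : (2 * (D.M : ℝ))⁻¹ * (∑ r, ‖Y r - D.fit O r‖ ^ 2
        - 2 * ∑ j, ∑ m, inner ℝ (D.score Y m j) (Dl m j))
      = (2 * (D.M : ℝ))⁻¹ * ∑ r, ‖Y r - D.fit O r‖ ^ 2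
        - (D.M : ℝ)⁻¹ * ∑ j, ∑ m, inner ℝ (D.score Y m j) (Dl m j) := by
    rw [mul_sub, mul_inv]; ring
  rw [hexp] at hq2
  simp only [objective]
  linarith

end Federation

namespace Federation

variable {D : Federation} {Ω : Type*} [MeasurableSpace Ω] {μ : Measure Ω}
  {sigma c₁ : ℝ} {E : Ω → D.Resp}

/-! ### Consequences of the noise conditions -/

lemma NoiseCond.measurable_entry (h : D.NoiseCond μ sigma c₁ E) (r : D.Obs) (l : Fin D.q) :
    Measurable fun ω => E ω r l := by
  have h1 : Continuous fun e : D.Resp => e r l := by fun_prop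
  exact h1.measurable.comp h.meas

lemma NoiseCond.indep_col (h : D.NoiseCond μ sigma c₁ E) (l : Fin D.q) :
    iIndepFun (fun (r : D.Obs) ω => E ω r l) μ :=
  h.indep.precomp (g := fun r : D.Obs => (r, l)) fun _ _ hrr => (Prod.ext_iff.1 hrr).1

variable [IsProbabilityMeasure μ]

lemma NoiseCond.tail_le (h : D.NoiseCond μ sigma c₁ E) {v : D.Obs → ℝ} {b : ℝ} (hb : 0 < b)
    (hv : v ⬝ᵥ v ≤ b ^ 2) (l : Fin D.q) {x : ℝ} (hx : 0 < x) :
    μ.real {ω | b * x ≤ |v ⬝ᵥ col (E ω) l|} ≤ 2 * Real.exp (-c₁ * x ^ 2) := by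
  have hmeas : Measurable fun ω => v ⬝ᵥ col (E ω) l := by
    simp only [dotProduct, col]
    exact Finset.measurable_sum _ fun r _ => (h.measurable_entry r l).const_mul _
  by_cases hv0 : v = 0
  · have : {ω | b * x ≤ |v ⬝ᵥ col (E ω) l|} = ∅ := by
      ext ω
      simp only [hv0, zero_dotProduct, abs_zero, Set.mem_ofPred_eq, Set.mem_empty_iff_false,
        iff_false, not_le]
      positivity
    rw [this, measureReal_empty]
    positivity
  set w : EuclideanSpace ℝ D.Obs := WithLp.toLp 2 v with hw
  have hw0 : w ≠ 0 := fun h0 => hv0 (by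
    have := congrArg WithLp.ofLp h0
    simpa [hw] using this)
  have hnorm : ‖w‖ ≤ b := by
    refine abs_le_of_sq_le_sq' ?_ hb.le |>.2
    rw [EuclideanSpace.norm_sq_eq]
    simpa [hw, dotProduct, sq] using hv
  have h1 := h.subgaussian l w hw0 x hx
  have hset : {ω | b * x ≤ |v ⬝ᵥ col (E ω) l|} ⊆ {ω | |∑ r, w r * E ω r l| < ‖w‖ * x}ᶜ := by
    intro ω hω
    simp only [Set.mem_ofPred_eq, Set.mem_compl_iff, not_lt] at hω ⊢
    exact (mul_le_mul_of_nonneg_right hnorm hx.le).trans hω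
  refine (measureReal_mono hset).trans ?_
  rw [probReal_compl_eq_one_sub]
  · linarith
  · exact measurableSet_lt hmeas.abs measurable_const

lemma NoiseCond.exists_fourth_moment_bound (hc₁ : 0 < c₁) :
    ∃ K : ℝ, 0 ≤ K ∧ ∀ {D : Federation} {Ω : Type*} [MeasurableSpace Ω] {μ : Measure Ω}
      [IsProbabilityMeasure μ] {sigma : ℝ} {E : Ω → D.Resp}, D.NoiseCond μ sigma c₁ E →
      ∀ r l, ∫ ω, E ω r l ^ 4 ∂μ ≤ K := by
  classical
  obtain ⟨K, hK, hbound⟩ := SROF.exists_fourth_moment_bound hc₁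
  refine ⟨K, hK, fun h r l => hbound _ _ (h.measurable_entry r l).aemeasurable fun x hx => ?_⟩
  have := h.tail_le (v := Pi.single r 1) one_pos (by simp) l hx
  simpa [col] using this

/-- Second moment of a linear image of the noise matrix. -/
lemma NoiseCond.integral_sum_sq_mulVec (h : D.NoiseCond μ sigma c₁ E) {κ : Type*} [Fintype κ]
    (A : Matrix κ D.Obs ℝ) :
    Integrable (fun ω => ∑ l, ∑ s, (A *ᵥ col (E ω) l) s ^ 2) μ ∧
    ∫ ω, ∑ l, ∑ s, (A *ᵥ col (E ω) l) s ^ 2 ∂μ = D.q * sigma ^ 2 * ∑ s, ∑ r, A s r ^ 2 := by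
  have hint : ∀ l s, Integrable (fun ω => (A *ᵥ col (E ω) l) s ^ 2) μ := fun l s =>
    integrable_sq_weighted_sum (X := fun r ω => E ω r l) (fun r => h.memLp r l) (A s)
  refine ⟨integrable_finsetSum _ fun l _ => integrable_finsetSum _ fun s _ => hint l s, ?_⟩
  rw [integral_finsetSum _ fun l _ => integrable_finsetSum _ fun s _ => hint l s]
  have h1 : ∀ l, ∫ ω, ∑ s, (A *ᵥ col (E ω) l) s ^ 2 ∂μ = sigma ^ 2 * ∑ s, ∑ r, A s r ^ 2 := by
    intro l
    rw [integral_finsetSum _ fun s _ => hint l s, Finset.mul_sum]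
    exact Finset.sum_congr rfl fun s _ => integral_sq_weighted_sum (X := fun r ω => E ω r l)
      (h.indep_col l) (fun r => h.memLp r l) (fun r => h.mean r l) (fun r => h.var r l) (A s)
  simp [h1, mul_assoc]

lemma NoiseCond.measureReal_sum_sq_mulVec_ge_le (h : D.NoiseCond μ sigma c₁ E) {κ : Type*}
    [Fintype κ] (A : Matrix κ D.Obs ℝ) {t : ℝ} (ht : 0 < t) :
    μ.real {ω | t ≤ ∑ l, ∑ s, (A *ᵥ col (E ω) l) s ^ 2}
      ≤ D.q * sigma ^ 2 * (∑ s, ∑ r, A s r ^ 2) / t := by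
  obtain ⟨hi, he⟩ := h.integral_sum_sq_mulVec A
  have := mul_meas_ge_le_integral_of_nonneg (μ := μ)
    (Eventually.of_forall fun ω => Finset.sum_nonneg fun l _ => Finset.sum_nonneg fun s _ =>
      sq_nonneg ((A *ᵥ col (E ω) l) s)) hi t
  rw [he] at this
  rw [le_div_iff₀ ht, mul_comm]
  exact this

/-- Union bound over finitely many linear forms in all columns of the noise. -/
lemma NoiseCond.measureReal_exists_ge_le (h : D.NoiseCond μ sigma c₁ E) {κ : Type*} [Fintype κ]
    (v : κ → D.Obs → ℝ) {b : ℝ} (hb : 0 < b) (hv : ∀ i, v i ⬝ᵥ v i ≤ b ^ 2) {x : ℝ}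
    (hx : 0 < x) :
    μ.real {ω | ∃ i l, b * x ≤ |v i ⬝ᵥ col (E ω) l|}
      ≤ Fintype.card κ * D.q * (2 * Real.exp (-c₁ * x ^ 2)) := by
  have hset : {ω | ∃ i l, b * x ≤ |v i ⬝ᵥ col (E ω) l|}
      = ⋃ i : κ × Fin D.q, {ω | b * x ≤ |v i.1 ⬝ᵥ col (E ω) i.2|} := by
    ext ω; simp
  rw [hset]
  refine (measureReal_iUnion_fintype_le _).trans ?_
  calc _ ≤ ∑ _i : κ × Fin D.q, 2 * Real.exp (-c₁ * x ^ 2) :=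
        Finset.sum_le_sum fun i _ => h.tail_le hb (hv i.1) i.2 hx
    _ = _ := by simp [mul_assoc]

/-! ### The oracle estimator is a local minimizer with high probability -/

/-- The columns that enter the score: those of the zero groups, and the column of every covariate
restricted to a single client. -/
def scoreColumn (D : Federation) : D.Group ⊕ (Fin D.M × Fin D.p) → D.Obs → ℝ
  | .inl s => fun r => open Classical in if D.Phi0 s = 0 then D.design r s else 0
  | .inr i => fun r => if r.1 = i.1 then D.X r i.2 else 0

lemma groupN_le_total (s : D.Group) : D.groupN s ≤ D.total :=
  Finset.sum_le_sum_of_subset (Finset.subset_univ _)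

/-- Client columns of zero groups are bounded through the normalization of the group column, those
of nonzero groups through the largest eigenvalue of the client's design. -/
lemma scoreColumn_dotProduct_self_le {c₂ c₃ c₄ : ℝ} (h : D.DesignCond c₂ c₃ c₄)
    (i : D.Group ⊕ (Fin D.M × Fin D.p)) :
    D.scoreColumn i ⬝ᵥ D.scoreColumn i ≤ max 1 c₄ * D.total := by
  have hnn : (0 : ℝ) ≤ max 1 c₄ := zero_le_one.trans (le_max_left _ _)
  have hone : ∀ s : D.Group, (D.groupN s : ℝ) ≤ max 1 c₄ * D.total := fun s => by
    have h1 : (D.groupN s : ℝ) ≤ D.total := by exact_mod_cast groupN_le_total s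
    have h2 : (0 : ℝ) ≤ D.total := Nat.cast_nonneg _
    nlinarith [le_max_left 1 c₄]
  rcases i with s | ⟨m, j⟩
  · by_cases hs : D.Phi0 s = 0
    · have := h.zero_col s hs
      simp only [scoreColumn, hs, if_true, dotProduct, ← sq]
      rw [this]
      exact hone s
    · simp only [scoreColumn, hs, if_false, dotProduct, mul_zero, Finset.sum_const_zero]
      positivity
  · have e : D.scoreColumn (.inr (m, j)) ⬝ᵥ D.scoreColumn (.inr (m, j))
        = ∑ i, D.X ⟨m, i⟩ j ^ 2 := by
      simp only [scoreColumn, dotProduct]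
      rw [Fintype.sum_sigma, Finset.sum_eq_single m]
      · simp [sq]
      · intro m' _ hm'
        simp [hm']
      · simp
    rw [e]
    by_cases hs : D.Phi0 ⟨j, D.grp j m⟩ = 0
    · refine le_trans ?_ (hone ⟨j, D.grp j m⟩)
      rw [← h.zero_col _ hs, Fintype.sum_sigma]
      refine le_trans (le_of_eq ?_) (Finset.single_le_sum
        (f := fun m' => ∑ i, D.design ⟨m', i⟩ ⟨j, D.grp j m⟩ ^ 2)
        (fun m' _ => Finset.sum_nonneg fun i _ => sq_nonneg _) (Finset.mem_univ m))
      simp [design]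
    · have := h.max_eigenvalue m (Pi.single j 1) fun j' hj' => by
        refine Pi.single_eq_of_ne ?_ 1
        rintro rfl
        exact hs hj'
      have h2 : ∑ j', (Pi.single j (1 : ℝ) : Fin D.p → ℝ) j' ^ 2 = 1 := by
        simp [Pi.single_apply]
      rw [h2, mul_one] at this
      simp only [Pi.single_apply, mul_ite, mul_one, mul_zero, Finset.sum_ite_eq', Finset.mem_univ,
        if_true] at this
      refine this.trans ?_
      have h3 : (D.n m : ℝ) ≤ D.total := by
        exact_mod_cast Finset.single_le_sum (f := D.n) (fun _ _ => Nat.zero_le _)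
          (Finset.mem_univ m)
      exact mul_le_mul (le_max_right _ _) h3 (Nat.cast_nonneg _) hnn

lemma norm_le_sqrt_mul_of_forall_abs_le {q : ℕ} (y : EuclideanSpace ℝ (Fin q)) {B : ℝ}
    (hB : 0 ≤ B) (h : ∀ l, |y l| ≤ B) : ‖y‖ ≤ √q * B := by
  rw [EuclideanSpace.norm_eq, ← Real.sqrt_sq hB, ← Real.sqrt_mul (Nat.cast_nonneg _)]
  refine Real.sqrt_le_sqrt ?_
  calc _ ≤ ∑ _l : Fin q, B ^ 2 := Finset.sum_le_sum fun l _ => by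
        rw [Real.norm_eq_abs]
        exact pow_le_pow_left₀ (abs_nonneg _) (h l) 2
    _ = _ := by simp

lemma sum_smul_resid_apply (hG : IsUnit (D.design₁ᵀ * D.design₁).det) (e : D.Resp)
    (v : D.Obs → ℝ) (l : Fin D.q) :
    (∑ r, v r • D.resid (D.response e) r) l
      = (residMatrix D.design₁ *ᵥ v) ⬝ᵥ col e l := by
  have h1 : (∑ r, v r • D.resid (D.response e) r) l
      = v ⬝ᵥ (residMatrix D.design₁ *ᵥ col e l) := by
    simp [dotProduct, resid_response_apply hG]
  rw [h1, dotProduct_mulVec, ← mulVec_transpose, residMatrix_isSymm]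

lemma score_eq_sum_scoreColumn (Y : D.Resp) (m : Fin D.M) (j : Fin D.p) :
    D.score Y m j = ∑ r, D.scoreColumn (.inr (m, j)) r • D.resid Y r := by
  rw [Fintype.sum_sigma, Finset.sum_eq_single m]
  · simp [score, scoreColumn]
  · intro m' _ hm'
    simp [scoreColumn, hm']
  · simp

lemma Gmin_le (s : D.Group) : D.Gmin ≤ (D.members s).card := ciInf_le (OrderBot.bddBelow _) s

lemma Nmin_le (s : D.Group) : D.Nmin ≤ D.groupN s := ciInf_le (OrderBot.bddBelow _) s

/-- Deterministic core of the oracle property: small noise functionals make the oracle estimator a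
local minimizer. -/
lemma isLocalMin_oracle_response {a : ℝ} {pen₁ pen₂ : ℝ → ℝ → ℝ} (hpen₁ : IsConcavePenalty a pen₁)
    (hpen₂ : IsConcavePenalty a pen₂) {lam₁ lam₂ : ℝ} (hlam₁ : 0 < lam₁) (hlam₂ : 0 < lam₂)
    (hG : IsUnit (D.design₁ᵀ * D.design₁).det) {t B : ℝ} (ht : 0 < t) (hB : 0 ≤ B)
    (hsignal : ∀ s : D.Nonzero, a * lam₁ + t ≤ ‖D.Phi0 s.1‖)
    (hgap : ∀ (j : Fin D.p) (s s' : Fin (D.S j)), s ≠ s' →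
      a * lam₂ + 2 * t ≤ ‖D.Phi0 ⟨j, s⟩ - D.Phi0 ⟨j, s'⟩‖)
    (hB₁ : √D.q * B ≤ D.M * D.Gmin * (lam₁ / 2)) (hB₂ : √D.q * B ≤ D.M * D.Gmin * (lam₂ / 4))
    (e : D.Resp)
    (hcoef : ∑ l, ∑ s, (lsMatrix D.design₁ *ᵥ col e l) s ^ 2 < t ^ 2)
    (hscore : ∀ i l, |(residMatrix D.design₁ *ᵥ D.scoreColumn i) ⬝ᵥ col e l| ≤ B) :
    IsLocalMin (D.objective pen₁ pen₂ lam₁ lam₂ (D.response e)) (D.oracle (D.response e)) := by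
  set Y := D.response e with hY
  have hclose : ∀ s : D.Nonzero, ‖D.oracleCoef Y s - D.Phi0 s.1‖ < t := by
    intro s
    refine abs_lt_of_sq_lt_sq' ?_ ht.le |>.2
    refine lt_of_le_of_lt ?_ hcoef
    rw [EuclideanSpace.norm_sq_eq]
    refine Finset.sum_le_sum fun l _ => ?_
    rw [PiLp.sub_apply, oracleCoef_response_apply hG, add_sub_cancel_left, Real.norm_eq_abs, sq_abs]
    exact Finset.single_le_sum (f := fun s => (lsMatrix D.design₁ *ᵥ col e l) s ^ 2)
      (fun s _ => sq_nonneg _) (Finset.mem_univ s)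
  have hcloseO : ∀ m j, ‖D.oracle Y m j - D.Phi0 ⟨j, D.grp j m⟩‖ < t := by
    intro m j
    by_cases h : D.Phi0 ⟨j, D.grp j m⟩ = 0
    · rw [oracle, ofNonzero_apply_of_eq h, h]; simpa using ht
    · rw [oracle, ofNonzero_apply_of_ne h]; exact hclose ⟨_, h⟩
  refine isLocalMin_oracle hpen₁ hpen₂ hlam₁ hlam₂ hG Y (fun m j h => ?_) (fun m m' j h => ?_)
    (fun s hs => ?_) (fun m j => ?_)
  · have h1 := hsignal ⟨_, h⟩
    have h2 := hcloseO m j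
    have h3 := norm_sub_norm_le (D.Phi0 ⟨j, D.grp j m⟩) (D.oracle Y m j)
    rw [norm_sub_rev] at h3
    linarith
  · have h1 := hgap j _ _ h
    have h2 := hcloseO m j
    have h3 := hcloseO m' j
    have h4 : D.Phi0 ⟨j, D.grp j m⟩ - D.Phi0 ⟨j, D.grp j m'⟩
        = (D.oracle Y m j - D.oracle Y m' j)
          - ((D.oracle Y m j - D.Phi0 ⟨j, D.grp j m⟩)
            - (D.oracle Y m' j - D.Phi0 ⟨j, D.grp j m'⟩)) := by abel
    rw [h4] at h1
    have h5 := h1.trans ((norm_sub_le _ _).trans (add_le_add le_rfl (norm_sub_le _ _)))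
    linarith
  · have h1 : ∑ r, D.design r s • D.resid Y r
        = ∑ r, D.scoreColumn (.inl s) r • D.resid Y r := by simp [scoreColumn, hs]
    rw [h1]
    refine (norm_le_sqrt_mul_of_forall_abs_le _ hB fun l => ?_).trans (hB₁.trans ?_)
    · rw [sum_smul_resid_apply hG]; exact hscore _ l
    · gcongr; exact Gmin_le s
  · rw [score_eq_sum_scoreColumn]
    refine (norm_le_sqrt_mul_of_forall_abs_le _ hB fun l => ?_).trans (hB₂.trans ?_)
    · rw [sum_smul_resid_apply hG]; exact hscore _ l
    · gcongr; exact Gmin_le _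

lemma numGroups_eq_card : D.numGroups = Fintype.card D.Group := by
  simp [numGroups]

/-- Lower bound on the probability that the oracle estimator is a local minimizer: a union bound for
the score and Markov's inequality for the coefficient error, of which `t` is the admissible size. -/
lemma one_sub_le_measureReal_oracle {a : ℝ} {pen₁ pen₂ : ℝ → ℝ → ℝ}
    (hpen₁ : IsConcavePenalty a pen₁)
    (hpen₂ : IsConcavePenalty a pen₂) {lam₁ lam₂ : ℝ} (hlam₁ : 0 < lam₁) (hlam₂ : 0 < lam₂)
    {c₂ c₃ c₄ : ℝ} (hc₂ : 0 < c₂) (hN : 0 < D.Nmin) (hD : D.DesignCond c₂ c₃ c₄)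
    (hE : D.NoiseCond μ sigma c₁ E) {t x : ℝ} (ht : 0 < t) (hx : 0 < x)
    (hsignal : ∀ s : D.Nonzero, a * lam₁ + t ≤ ‖D.Phi0 s.1‖)
    (hgap : ∀ (j : Fin D.p) (s s' : Fin (D.S j)), s ≠ s' →
      a * lam₂ + 2 * t ≤ ‖D.Phi0 ⟨j, s⟩ - D.Phi0 ⟨j, s'⟩‖)
    (hB₁ : √D.q * (√(max 1 c₄ * D.total) * x) ≤ D.M * D.Gmin * (lam₁ / 2))
    (hB₂ : √D.q * (√(max 1 c₄ * D.total) * x) ≤ D.M * D.Gmin * (lam₂ / 4)) :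
    1 - ((D.numGroups + D.M * D.p : ℝ) * D.q * (2 * Real.exp (-c₁ * x ^ 2))
        + D.q * sigma ^ 2 * (D.numNonzero / (c₂ * D.Nmin)) / t ^ 2)
      ≤ μ.real {ω | IsLocalMin (D.objective pen₁ pen₂ lam₁ lam₂ (D.response (E ω)))
            (D.oracle (D.response (E ω)))
          ∧ D.IsOracle (D.response (E ω)) (D.oracle (D.response (E ω)))} := by
  have hcN : 0 < c₂ * (D.Nmin : ℝ) := by positivity
  have hG := isUnit_det_gram hcN hD.min_eigenvalue
  have htot : (0 : ℝ) < D.total := by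
    have : D.Nmin ≤ D.total :=
      (Nmin_le ⟨⟨0, D.p_pos⟩, D.grp ⟨0, D.p_pos⟩ ⟨0, D.M_pos⟩⟩).trans (groupN_le_total _)
    exact_mod_cast hN.trans_le this
  have hmax : (0 : ℝ) < max 1 c₄ := lt_max_of_lt_left one_pos
  set b := √(max 1 c₄ * D.total) with hb
  have hb0 : 0 < b := Real.sqrt_pos.2 (by positivity)
  have hb2 : b ^ 2 = max 1 c₄ * D.total := Real.sq_sqrt (by positivity)
  set bad₁ := {ω | ∃ i l, b * x ≤ |(residMatrix D.design₁ *ᵥ D.scoreColumn i) ⬝ᵥ col (E ω) l|}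
    with hbad₁
  set bad₂ := {ω | t ^ 2 ≤ ∑ l, ∑ s, (lsMatrix D.design₁ *ᵥ col (E ω) l) s ^ 2} with hbad₂
  set good := {ω | IsLocalMin (D.objective pen₁ pen₂ lam₁ lam₂ (D.response (E ω)))
            (D.oracle (D.response (E ω)))
          ∧ D.IsOracle (D.response (E ω)) (D.oracle (D.response (E ω)))}
  have h1 : μ.real bad₁ ≤ (D.numGroups + D.M * D.p : ℝ) * D.q * (2 * Real.exp (-c₁ * x ^ 2)) := by
    refine (hE.measureReal_exists_ge_le _ hb0 (fun i => ?_) hx).trans (le_of_eq ?_)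
    · rw [hb2]
      exact (residMatrix_dotProduct_self_le hG _).trans (scoreColumn_dotProduct_self_le hD i)
    · rw [Fintype.card_sum, Fintype.card_prod, Fintype.card_fin, Fintype.card_fin,
        numGroups_eq_card]
      push_cast
      rfl
  have h2 : μ.real bad₂ ≤ D.q * sigma ^ 2 * (D.numNonzero / (c₂ * D.Nmin)) / t ^ 2 := by
    refine (hE.measureReal_sum_sq_mulVec_ge_le _ (by positivity)).trans ?_
    have := mul_sum_sq_lsMatrix_le hcN hD.min_eigenvalue
    gcongr
    rw [le_div_iff₀ hcN, mul_comm]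
    exact this
  have hcover : (Set.univ : Set Ω) ⊆ good ∪ (bad₁ ∪ bad₂) := by
    intro ω _
    by_contra hcon
    simp only [Set.mem_union, not_or] at hcon
    obtain ⟨hg, hn1, hn2⟩ := hcon
    refine hg ⟨isLocalMin_oracle_response hpen₁ hpen₂ hlam₁ hlam₂ hG ht (B := b * x)
      (by positivity) hsignal hgap hB₁ hB₂ (E ω) ?_ ?_, isOracle_oracle hG _⟩
    · simpa [hbad₂] using hn2
    · intro i l
      simp only [hbad₁, Set.mem_ofPred_eq, not_exists, not_le] at hn1
      exact (hn1 i l).le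
  have h3 : (1 : ℝ) ≤ μ.real good + (μ.real bad₁ + μ.real bad₂) := by
    calc (1 : ℝ) = μ.real Set.univ := by simp
      _ ≤ μ.real (good ∪ (bad₁ ∪ bad₂)) := measureReal_mono hcover
      _ ≤ _ := (measureReal_union_le _ _).trans (by gcongr; exact measureReal_union_le _ _)
  linarith

end Federation

namespace Federation

variable {D : Federation} {Ω : Type*} [MeasurableSpace Ω] {μ : Measure Ω} [IsProbabilityMeasure μ]
  {sigma c₁ c₂ c₃ c₄ : ℝ} {E : Ω → D.Resp}

/-! ### The studentized contrast -/

lemma contrast_oracle_response (hG : IsUnit (D.design₁ᵀ * D.design₁).det)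
    (u : EuclideanSpace ℝ D.Nonzero) (c : EuclideanSpace ℝ (Fin D.q)) (e : D.Resp) :
    D.contrast u c (D.oracle (D.response e))
      = ∑ i : D.Obs × Fin D.q, ((lsMatrix D.design₁)ᵀ *ᵥ u.ofLp) i.1 * c i.2 * e i.1 i.2 := by
  have h1 : ∀ s l, u s * (D.groupCoef (D.oracle (D.response e)) s.1 l - D.Phi0 s.1 l) * c l
      = u s * (lsMatrix D.design₁ *ᵥ col e l) s * c l := fun s l => by
    rw [oracle, groupCoef_ofNonzero, oracleCoef_response_apply hG, add_sub_cancel_left]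
  simp only [contrast, h1]
  rw [Fintype.sum_prod_type_right, Finset.sum_comm]
  refine Finset.sum_congr rfl fun l _ => ?_
  have h2 : ∑ r, ((lsMatrix D.design₁)ᵀ *ᵥ u.ofLp) r * c l * e r l
      = (((lsMatrix D.design₁)ᵀ *ᵥ u.ofLp) ⬝ᵥ col e l) * c l := by
    rw [dotProduct, Finset.sum_mul]
    exact Finset.sum_congr rfl fun r _ => by rw [col]; ring
  rw [h2, mulVec_transpose, ← dotProduct_mulVec, dotProduct, Finset.sum_mul]

/-- The residual variance is the mean square of the noise minus the part of the noise that lies in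
the column space of `𝕏₁`. -/
lemma sigmaSq_oracle_response (hG : IsUnit (D.design₁ᵀ * D.design₁).det) (e : D.Resp) :
    D.sigmaSq (D.response e) (D.oracle (D.response e))
      = ((D.total : ℝ) * D.q)⁻¹ * ∑ i : D.Obs × Fin D.q, e i.1 i.2 ^ 2
        - ((D.total : ℝ) * D.q)⁻¹
          * ∑ l, ∑ r, ((D.design₁ * lsMatrix D.design₁) *ᵥ col e l) r ^ 2 := by
  have h1 : ∑ r, ‖D.response e r - D.fit (D.oracle (D.response e)) r‖ ^ 2
      = ∑ l, (col e l ⬝ᵥ col e l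
        - ∑ r, ((D.design₁ * lsMatrix D.design₁) *ᵥ col e l) r ^ 2) := by
    change ∑ r, ‖D.resid (D.response e) r‖ ^ 2 = _
    rw [sum_norm_sq_eq]
    refine Finset.sum_congr rfl fun l _ => ?_
    have h2 : col (D.resid (D.response e)) l = residMatrix D.design₁ *ᵥ col e l := by
      ext r; exact resid_response_apply hG e r l
    rw [h2, residMatrix_dotProduct_self hG]
    simp [dotProduct, sq]
  rw [sigmaSq, h1, Finset.sum_sub_distrib, mul_sub, Fintype.sum_prod_type_right]
  simp [dotProduct, sq, col]

lemma card_obs_prod : Fintype.card (D.Obs × Fin D.q) = D.total * D.q := by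
  simp [total]

/-- Consistency of the residual variance, with explicit rates. -/
lemma measureReal_sigmaSq_sub_ge_le (hG : IsUnit (D.design₁ᵀ * D.design₁).det)
    (htot : 0 < D.total) (hE : D.NoiseCond μ sigma c₁ E) {K : ℝ}
    (hK : ∀ r l, ∫ ω, E ω r l ^ 4 ∂μ ≤ K) {δ : ℝ} (hδ : 0 < δ) :
    μ.real {ω | δ ≤ |D.sigmaSq (D.response (E ω)) (D.oracle (D.response (E ω))) - sigma ^ 2|}
      ≤ K / ((D.total : ℝ) * D.q * (δ / 2) ^ 2)
        + sigma ^ 2 * (D.numNonzero / D.total) / (δ / 2) := by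
  have hq : (0 : ℝ) < D.q := by exact_mod_cast D.q_pos
  have hn : (0 : ℝ) < D.total := by exact_mod_cast htot
  have hcard : (Fintype.card (D.Obs × Fin D.q) : ℝ) = (D.total : ℝ) * D.q := by
    rw [card_obs_prod]; push_cast; rfl
  have : Nonempty (D.Obs × Fin D.q) := Fintype.card_pos_iff.1 (by
    rw [card_obs_prod]; exact Nat.mul_pos htot D.q_pos)
  have h1 := measureReal_mean_sq_sub_ge_le (X := fun (i : D.Obs × Fin D.q) ω => E ω i.1 i.2)
    hE.indep (fun i => hE.memLp i.1 i.2) (fun i => hE.var i.1 i.2) (fun i => hK i.1 i.2)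
    (half_pos hδ)
  rw [hcard] at h1
  have h2 := hE.measureReal_sum_sq_mulVec_ge_le (D.design₁ * lsMatrix D.design₁)
    (t := (D.total : ℝ) * D.q * (δ / 2)) (by positivity)
  rw [sum_sq_hatMatrix hG] at h2
  have e2 : (D.q : ℝ) * sigma ^ 2 * (Fintype.card D.Nonzero) / ((D.total : ℝ) * D.q * (δ / 2))
      = sigma ^ 2 * (D.numNonzero / D.total) / (δ / 2) := by
    rw [numNonzero]; field_simp
  rw [e2] at h2
  refine le_trans ?_ (add_le_add h1 h2)
  refine le_trans (measureReal_mono ?_) (measureReal_union_le _ _)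
  intro ω hω
  by_contra hcon
  simp only [Set.mem_union, Set.mem_ofPred_eq, not_or, not_le] at hcon hω
  obtain ⟨h3, h4⟩ := hcon
  rw [sigmaSq_oracle_response hG] at hω
  set S := ∑ l, ∑ r, ((D.design₁ * lsMatrix D.design₁) *ᵥ col (E ω) l) r ^ 2
  have hS0 : 0 ≤ S := Finset.sum_nonneg fun l _ => Finset.sum_nonneg fun r _ => sq_nonneg _
  have h5 : ((D.total : ℝ) * D.q)⁻¹ * S < δ / 2 := by
    rw [← div_eq_inv_mul, div_lt_iff₀ (by positivity), mul_comm]; exact h4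
  have h6 : 0 ≤ ((D.total : ℝ) * D.q)⁻¹ * S := by positivity
  rw [abs_lt] at h3
  rcases le_abs.1 hω with h | h <;> linarith [h3.1, h3.2]

/-- The contrast of the oracle estimator divided by its exact standard deviation. -/
def standardizedContrast (D : Federation) (sigma : ℝ) (u : EuclideanSpace ℝ D.Nonzero)
    (c : EuclideanSpace ℝ (Fin D.q)) (e : D.Resp) : ℝ :=
  (sigma * √(u.ofLp ⬝ᵥ ((D.design₁ᵀ * D.design₁)⁻¹ *ᵥ u.ofLp)))⁻¹
    * D.contrast u c (D.oracle (D.response e))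

/-- The weight of the noise entry `(r, l)` in the standardized contrast. -/
def contrastWeight (D : Federation) (sigma : ℝ) (u : EuclideanSpace ℝ D.Nonzero)
    (c : EuclideanSpace ℝ (Fin D.q)) (i : D.Obs × Fin D.q) : ℝ :=
  (sigma * √(u.ofLp ⬝ᵥ ((D.design₁ᵀ * D.design₁)⁻¹ *ᵥ u.ofLp)))⁻¹
    * (((lsMatrix D.design₁)ᵀ *ᵥ u.ofLp) i.1 * c i.2)

lemma standardizedContrast_eq (hG : IsUnit (D.design₁ᵀ * D.design₁).det)
    (u : EuclideanSpace ℝ D.Nonzero) (c : EuclideanSpace ℝ (Fin D.q)) (e : D.Resp) :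
    D.standardizedContrast sigma u c e
      = ∑ i : D.Obs × Fin D.q, D.contrastWeight sigma u c i * e i.1 i.2 := by
  rw [standardizedContrast, contrast_oracle_response hG, Finset.mul_sum]
  exact Finset.sum_congr rfl fun i _ => by rw [contrastWeight]; ring

lemma ofLp_ne_zero_of_norm_eq_one {ι : Type*} [Fintype ι] {u : EuclideanSpace ℝ ι}
    (hu : ‖u‖ = 1) : u.ofLp ≠ 0 := by
  intro h
  have : u = 0 := by ext i; exact congrFun h i
  simp [this] at hu

lemma sum_sq_contrastWeight (hsigma : 0 < sigma) (hcN : 0 < c₂ * (D.Nmin : ℝ))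
    (hD : D.DesignCond c₂ c₃ c₄) {u : EuclideanSpace ℝ D.Nonzero}
    {c : EuclideanSpace ℝ (Fin D.q)} (hu : ‖u‖ = 1) (hc : ‖c‖ = 1) :
    ∑ i, D.contrastWeight sigma u c i ^ 2 * sigma ^ 2 = 1 := by
  have hG := isUnit_det_gram hcN hD.min_eigenvalue
  have hκ := inv_gram_quadratic_pos hcN hD.min_eigenvalue (ofLp_ne_zero_of_norm_eq_one hu)
  have hw := sum_sq_lsMatrix_transpose_mulVec hG u.ofLp
  have hc2 : ∑ l, c l ^ 2 = 1 := by
    have := EuclideanSpace.norm_sq_eq c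
    rw [hc] at this
    simpa using this.symm
  have h1 : ∑ i : D.Obs × Fin D.q, (((lsMatrix D.design₁)ᵀ *ᵥ u.ofLp) i.1 * c i.2) ^ 2
      = u.ofLp ⬝ᵥ ((D.design₁ᵀ * D.design₁)⁻¹ *ᵥ u.ofLp) := by
    simp_rw [mul_pow]
    rw [Fintype.sum_prod_type]
    simp_rw [← Finset.mul_sum, hc2, mul_one]
    exact hw
  simp_rw [contrastWeight, mul_pow _ _ 2]
  simp_rw [mul_pow _ _ 2] at h1
  rw [← Finset.sum_mul, ← Finset.mul_sum, h1, inv_pow, mul_pow, Real.sq_sqrt hκ.le]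
  field_simp

lemma abs_contrastWeight_le (hsigma : 0 < sigma) (hcN : 0 < c₂ * (D.Nmin : ℝ))
    (hD : D.DesignCond c₂ c₃ c₄) {u : EuclideanSpace ℝ D.Nonzero}
    {c : EuclideanSpace ℝ (Fin D.q)} (hu : ‖u‖ = 1) (hc : ‖c‖ = 1) (i : D.Obs × Fin D.q) :
    |D.contrastWeight sigma u c i| ≤ √(c₃ * D.q / (c₂ * D.Nmin)) / sigma := by
  have hκ := inv_gram_quadratic_pos hcN hD.min_eigenvalue (ofLp_ne_zero_of_norm_eq_one hu)
  set κ := u.ofLp ⬝ᵥ ((D.design₁ᵀ * D.design₁)⁻¹ *ᵥ u.ofLp) with hκdef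
  have h1 := sq_lsMatrix_transpose_mulVec_le hcN hD.min_eigenvalue (hD.row i.1) u.ofLp
  rw [← hκdef] at h1
  have h2 : |((lsMatrix D.design₁)ᵀ *ᵥ u.ofLp) i.1| ≤ √(c₃ * D.q / (c₂ * D.Nmin)) * √κ := by
    rw [← Real.sqrt_mul' _ hκ.le]
    exact Real.abs_le_sqrt h1
  have h3 : |c i.2| ≤ 1 := by
    rw [← hc, ← Real.norm_eq_abs]; exact PiLp.norm_apply_le c i.2
  have hsκ : 0 < √κ := Real.sqrt_pos.2 hκ
  rw [contrastWeight, abs_mul, abs_mul, abs_inv, abs_mul, abs_of_pos hsigma, abs_of_pos hsκ,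
    ← div_eq_inv_mul, div_le_div_iff₀ (by positivity) hsigma]
  calc _ ≤ √(c₃ * D.q / (c₂ * D.Nmin)) * √κ * 1 * sigma := by gcongr
    _ = _ := by ring

lemma integral_sq_standardizedContrast (hsigma : 0 < sigma) (hcN : 0 < c₂ * (D.Nmin : ℝ))
    (hD : D.DesignCond c₂ c₃ c₄) (hE : D.NoiseCond μ sigma c₁ E)
    {u : EuclideanSpace ℝ D.Nonzero}
    {c : EuclideanSpace ℝ (Fin D.q)} (hu : ‖u‖ = 1) (hc : ‖c‖ = 1) :
    Integrable (fun ω => D.standardizedContrast sigma u c (E ω) ^ 2) μ ∧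
      ∫ ω, D.standardizedContrast sigma u c (E ω) ^ 2 ∂μ = 1 := by
  have hG := isUnit_det_gram hcN hD.min_eigenvalue
  simp_rw [standardizedContrast_eq hG]
  refine ⟨integrable_sq_weighted_sum (X := fun (i : D.Obs × Fin D.q) ω => E ω i.1 i.2)
    (fun i => hE.memLp i.1 i.2) _, ?_⟩
  rw [integral_sq_weighted_sum (X := fun (i : D.Obs × Fin D.q) ω => E ω i.1 i.2)
    hE.indep (fun i => hE.memLp i.1 i.2) (fun i => hE.mean i.1 i.2) (fun i => hE.var i.1 i.2),
    ← sum_sq_contrastWeight hsigma hcN hD hu hc, ← Finset.sum_mul, mul_comm]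

lemma norm_charFun_standardizedContrast_sub_le (hsigma : 0 < sigma)
    (hcN : 0 < c₂ * (D.Nmin : ℝ))
    (hD : D.DesignCond c₂ c₃ c₄) (hE : D.NoiseCond μ sigma c₁ E) {K : ℝ}
    (hK : ∀ r l, ∫ ω, E ω r l ^ 4 ∂μ ≤ K) {u : EuclideanSpace ℝ D.Nonzero}
    {c : EuclideanSpace ℝ (Fin D.q)} (hu : ‖u‖ = 1) (hc : ‖c‖ = 1) (t : ℝ) :
    ‖charFun (μ.map fun ω => D.standardizedContrast sigma u c (E ω)) t
        - Complex.exp (-(t ^ 2 / 2 : ℝ))‖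
      ≤ √(c₃ * D.q / (c₂ * D.Nmin)) / sigma * (4 * |t| ^ 3 * ((sigma ^ 2 + K) / sigma ^ 2))
        + (√(c₃ * D.q / (c₂ * D.Nmin)) / sigma) ^ 2 * (t ^ 4 * sigma ^ 2 / 4) := by
  have hG := isUnit_det_gram hcN hD.min_eigenvalue
  simp_rw [standardizedContrast_eq hG]
  exact norm_charFun_weighted_sum_sub_gaussian_le
    (X := fun (i : D.Obs × Fin D.q) ω => E ω i.1 i.2) hsigma hE.indep
    (fun i => hE.memLp i.1 i.2) (fun i => hE.mean i.1 i.2) (fun i => hE.var i.1 i.2)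
    (fun i => hK i.1 i.2) _ (sum_sq_contrastWeight hsigma hcN hD hu hc)
    (abs_contrastWeight_le hsigma hcN hD hu hc) t

/-- Studentization factors into the standardized contrast and a ratio that tends to one. The
identity also holds when `σ̂ = 0`, where both sides vanish. -/
lemma inv_stdErr_mul_contrast (hsigma : 0 < sigma) (u : EuclideanSpace ℝ D.Nonzero)
    (c : EuclideanSpace ℝ (Fin D.q)) (e : D.Resp) :
    (D.stdErr u (D.response e) (D.oracle (D.response e)))⁻¹
        * D.contrast u c (D.oracle (D.response e))
      = (sigma * (√(D.sigmaSq (D.response e) (D.oracle (D.response e))))⁻¹)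
        * D.standardizedContrast sigma u c e := by
  rw [stdErr, standardizedContrast, mul_inv, mul_inv]
  field_simp

lemma continuous_oracle : Continuous D.oracle := by
  refine continuous_pi fun m => continuous_pi fun j => ?_
  by_cases h : D.Phi0 ⟨j, D.grp j m⟩ = 0
  · simp only [oracle, ofNonzero_apply_of_eq h]
    exact continuous_const
  · simp only [oracle, ofNonzero_apply_of_ne h, oracleCoef]
    fun_prop

lemma continuous_response : Continuous D.response := by
  unfold response; fun_prop

lemma continuous_contrast (u : EuclideanSpace ℝ D.Nonzero) (c : EuclideanSpace ℝ (Fin D.q)) :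
    Continuous (D.contrast u c) := by
  unfold contrast groupCoef
  fun_prop

lemma continuous_sigmaSq_oracle_response :
    Continuous fun e => D.sigmaSq (D.response e) (D.oracle (D.response e)) := by
  have h1 : Continuous fun e => D.oracle (D.response e) :=
    continuous_oracle.comp continuous_response
  have h2 := continuous_response (D := D)
  unfold sigmaSq fit
  fun_prop

end Federation

/-! ### Asymptotics along the sequence of federations -/

namespace Federation

variable {D : Federation}

lemma Nmin_le_total : D.Nmin ≤ D.total :=
  (Nmin_le ⟨⟨0, D.p_pos⟩, D.grp ⟨0, D.p_pos⟩ ⟨0, D.M_pos⟩⟩).trans (groupN_le_total _)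

lemma M_le_total : D.M ≤ D.total := by
  calc D.M = ∑ _m : Fin D.M, 1 := by simp
    _ ≤ _ := Finset.sum_le_sum fun m _ => D.n_pos m

lemma S_pos (j : Fin D.p) : 0 < D.S j := (D.grp j ⟨0, D.M_pos⟩).pos

lemma p_le_numGroups : D.p ≤ D.numGroups := by
  calc D.p = ∑ _j : Fin D.p, 1 := by simp
    _ ≤ _ := Finset.sum_le_sum fun j _ => S_pos j

lemma Gmin_pos : 0 < D.Gmin := by
  have : Nonempty D.Group := ⟨⟨⟨0, D.p_pos⟩, D.grp ⟨0, D.p_pos⟩ ⟨0, D.M_pos⟩⟩⟩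
  obtain ⟨s, hs⟩ := ciInf_mem fun s => (D.members s).card
  rw [Gmin, ← hs]
  exact (members_nonempty s).card_pos

lemma groupN_pos (s : D.Group) : 0 < D.groupN s :=
  Finset.sum_pos (fun m _ => D.n_pos m) (members_nonempty s)

lemma Nmin_pos : 0 < D.Nmin := by
  have : Nonempty D.Group := ⟨⟨⟨0, D.p_pos⟩, D.grp ⟨0, D.p_pos⟩ ⟨0, D.M_pos⟩⟩⟩
  obtain ⟨s, hs⟩ := ciInf_mem fun s => D.groupN s
  rw [Nmin, ← hs]
  exact groupN_pos s

/-- The number of nonzero groups is negligible relative to the sample size. -/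
lemma numNonzero_div_total_le {c₂ c₃ c₄ : ℝ} (hc₂ : 0 < c₂) (hN : 0 < D.Nmin)
    (hD : D.DesignCond c₂ c₃ c₄) :
    (D.numNonzero : ℝ) / D.total ≤ c₃ / c₂ * (D.q / D.Nmin) := by
  have hN' : (0 : ℝ) < D.Nmin := by exact_mod_cast hN
  have hn : (0 : ℝ) < D.total := by exact_mod_cast hN.trans_le Nmin_le_total
  have h1 := card_mul_le_sum_sq hD.min_eigenvalue
  have h2 : ∑ r, ∑ s, D.design₁ r s ^ 2 ≤ D.total * (c₃ * D.q) := by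
    refine (Finset.sum_le_sum fun r _ => hD.row r).trans (le_of_eq ?_)
    simp [total]
  rw [div_mul_div_comm, div_le_div_iff₀ hn (by positivity)]
  have h3 := h1.trans h2
  rw [numNonzero]
  linarith

end Federation

lemma one_le_log_of_three_le {N : ℝ} (hN : 3 ≤ N) : 1 ≤ Real.log N := by
  rw [Real.le_log_iff_exp_le (by linarith)]
  linarith [Real.exp_one_lt_d9]

lemma log_le_of_rpow_le {n N q : ℝ} (hn : 0 < n) (hq : 1 ≤ q)
    (h : n ^ (3 / 4 : ℝ) * q ^ (1 / 2 : ℝ) ≤ N) : 3 / 4 * Real.log n ≤ Real.log N := by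
  rw [← Real.log_rpow hn]
  refine Real.log_le_log (Real.rpow_pos_of_pos hn _) (le_trans ?_ h)
  exact le_mul_of_one_le_right (Real.rpow_nonneg hn.le _) (Real.one_le_rpow hq (by norm_num))

/-- With `n` the total and `N` the smallest group sample size, the lower bound on `N` makes the
number of responses negligible relative to `N`. -/
lemma div_le_inv_sqrt_of_rpow_le {n N q : ℝ} (hn : 0 < n) (hN : 0 < N) (hq : 0 ≤ q) (hNn : N ≤ n)
    (h : n ^ (3 / 4 : ℝ) * q ^ (1 / 2 : ℝ) ≤ N) : q / N ≤ (√n)⁻¹ := by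
  have h1 : (n ^ (3 / 4 : ℝ) * q ^ (1 / 2 : ℝ)) ^ 2 ≤ N ^ 2 := by gcongr
  have e1 : (n ^ (3 / 4 : ℝ)) ^ 2 = n * √n := by
    rw [← Real.rpow_natCast, ← Real.rpow_mul hn.le, Real.sqrt_eq_rpow,
      ← Real.rpow_one_add' hn.le (by norm_num)]
    norm_num
  have e2 : (q ^ (1 / 2 : ℝ)) ^ 2 = q := by rw [← Real.sqrt_eq_rpow, Real.sq_sqrt hq]
  rw [mul_pow, e1, e2] at h1
  have hs : 0 < √n := Real.sqrt_pos.2 hn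
  rw [div_le_iff₀ hN, ← div_eq_inv_mul, le_div_iff₀ hs]
  have h2 : n * (q * √n) ≤ n * N := by nlinarith
  exact le_of_mul_le_mul_left h2 hn

/-- The deviation level of the union bound is dominated by the first penalty level. -/
lemma noise_level_le {n N q K c c₁ α θ : ℝ} (hq : 0 ≤ q) (hN : 3 ≤ N) (hNn : N ≤ n) (hα : 0 ≤ α)
    (hK : 0 ≤ K) (hc : 0 < c) (hc₁ : 0 < c₁) (hθ : 0 < θ)
    (hlog : 3 / 4 * Real.log n ≤ Real.log N) :
    √q * (√(c * n) * √((K * N ^ α + 3 * Real.log n) / c₁))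
      ≤ θ * (√(c * (K + 4) / c₁) / θ * (n * √(q * Real.log N / N ^ (1 - α)))) := by
  have hN0 : 0 < N := by linarith
  have hn0 : 0 < n := by linarith
  have hlN := one_le_log_of_three_le hN
  have hNα : 1 ≤ N ^ α := Real.one_le_rpow (by linarith) hα
  have hln : 0 ≤ Real.log n := Real.log_nonneg (by linarith)
  have e1 : θ * (√(c * (K + 4) / c₁) / θ * (n * √(q * Real.log N / N ^ (1 - α))))
      = √(c * (K + 4) / c₁ * (n ^ 2 * (q * Real.log N / N ^ (1 - α)))) := by
    rw [Real.sqrt_mul (by positivity), Real.sqrt_mul (by positivity), Real.sqrt_sq hn0.le]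
    field_simp
  rw [e1, ← Real.sqrt_mul (by positivity), ← Real.sqrt_mul hq]
  refine Real.sqrt_le_sqrt ?_
  have e2 : N ^ (1 - α) = N / N ^ α := by rw [Real.rpow_sub hN0, Real.rpow_one]
  have h1 : K * N ^ α + 3 * Real.log n ≤ (K + 4) * (Real.log N * N ^ α) := by
    have h2 : N ^ α ≤ Real.log N * N ^ α := le_mul_of_one_le_left (by linarith) hlN
    have h3 : Real.log N ≤ Real.log N * N ^ α := le_mul_of_one_le_right (by linarith) hNα
    nlinarith
  have h4 : 0 ≤ (K + 4) * (Real.log N * N ^ α) := by positivity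
  have h5 : 1 ≤ n / N := (one_le_div hN0).2 hNn
  calc q * (c * n * ((K * N ^ α + 3 * Real.log n) / c₁))
      ≤ q * (c * n * ((K + 4) * (Real.log N * N ^ α) / c₁)) := by gcongr
    _ ≤ q * (c * n * ((K + 4) * (Real.log N * N ^ α) / c₁)) * (n / N) :=
        le_mul_of_one_le_right (by positivity) h5
    _ = _ := by rw [e2]; field_simp

/-- With `S` groups and `M * p` client columns, the union bound at squared deviation level
`(K * L + 3 * log n) / c₁` is of order `1 / n`. -/
lemma union_bound_le {S n M p q K c₁ L : ℝ} (hS : 1 ≤ S) (hn : 1 ≤ n) (hp0 : 0 ≤ p)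
    (hq0 : 0 ≤ q) (hM : M ≤ n) (hp : p ≤ S) (hq : q ≤ n) (hc₁ : 0 < c₁)
    (hL : Real.log S ≤ K * L) (hK : 0 ≤ K * L) :
    (S + M * p) * q * (2 * Real.exp (-c₁ * √((K * L + 3 * Real.log n) / c₁) ^ 2)) ≤ 4 / n := by
  have hln : 0 ≤ Real.log n := Real.log_nonneg hn
  have hn0 : 0 < n := by linarith
  have hS0 : 0 < S := by linarith
  rw [Real.sq_sqrt (by positivity)]
  have e1 : -c₁ * ((K * L + 3 * Real.log n) / c₁) = -(K * L) + -(3 * Real.log n) := by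
    field_simp; ring
  have e2 : Real.exp (-(3 * Real.log n)) = (n ^ 3)⁻¹ := by
    rw [Real.exp_neg, show 3 * Real.log n = Real.log (n ^ 3) by rw [Real.log_pow]; norm_num,
      Real.exp_log (by positivity)]
  have h1 : Real.exp (-(K * L)) ≤ S⁻¹ := by
    rw [Real.exp_neg]
    refine inv_anti₀ hS0 ?_
    rwa [Real.log_le_iff_le_exp hS0] at hL
  rw [e1, Real.exp_add, e2]
  have h2 : S + M * p ≤ 2 * n * S := by nlinarith [mul_le_mul hM hp hp0 hn0.le]
  calc _ ≤ (2 * n * S) * n * (2 * (S⁻¹ * (n ^ 3)⁻¹)) := by gcongr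
    _ = 4 / n := by field_simp; ring

section Sequences

variable {Ω : ℕ → Type*} [∀ k, MeasurableSpace (Ω k)] {μ : (k : ℕ) → Measure (Ω k)}
  [∀ k, IsProbabilityMeasure (μ k)] {D : ℕ → Federation} {E : (k : ℕ) → Ω k → (D k).Resp}
  {a sigma c₁ c₂ c₃ c₄ α τ : ℝ} {pen₁ pen₂ : ℝ → ℝ → ℝ} {lam₁ lam₂ : ℕ → ℝ}

lemma eventually_rpow_le_Nmin
    (hNmin : MuchLarger (fun k => ((D k).Nmin : ℝ))
      (fun k => ((D k).total : ℝ) ^ (3 / 4 : ℝ) * ((D k).q : ℝ) ^ (1 / 2 : ℝ))) :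
    ∀ᶠ k in atTop, ((D k).total : ℝ) ^ (3 / 4 : ℝ) * ((D k).q : ℝ) ^ (1 / 2 : ℝ) ≤ (D k).Nmin := by
  filter_upwards [hNmin 1] with k hk
  simpa using hk

lemma one_le_q (D : Federation) : (1 : ℝ) ≤ D.q := by exact_mod_cast D.q_pos

lemma tendsto_Nmin (hn : Tendsto (fun k => (D k).total) atTop atTop)
    (hNmin : MuchLarger (fun k => ((D k).Nmin : ℝ))
      (fun k => ((D k).total : ℝ) ^ (3 / 4 : ℝ) * ((D k).q : ℝ) ^ (1 / 2 : ℝ))) :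
    Tendsto (fun k => ((D k).Nmin : ℝ)) atTop atTop := by
  have h1 : Tendsto (fun k => ((D k).total : ℝ) ^ (3 / 4 : ℝ)) atTop atTop :=
    (tendsto_rpow_atTop (by norm_num)).comp (tendsto_natCast_atTop_atTop.comp hn)
  refine tendsto_atTop_mono' _ ?_ h1
  filter_upwards [eventually_rpow_le_Nmin hNmin] with k hk
  exact le_trans (le_mul_of_one_le_right (by positivity)
    (Real.one_le_rpow (one_le_q (D k)) (by norm_num))) hk

lemma tendsto_q_div_Nmin (hn : Tendsto (fun k => (D k).total) atTop atTop)
    (hNmin : MuchLarger (fun k => ((D k).Nmin : ℝ))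
      (fun k => ((D k).total : ℝ) ^ (3 / 4 : ℝ) * ((D k).q : ℝ) ^ (1 / 2 : ℝ))) :
    Tendsto (fun k => ((D k).q : ℝ) / (D k).Nmin) atTop (𝓝 0) := by
  have h1 : Tendsto (fun k => (√((D k).total : ℝ))⁻¹) atTop (𝓝 0) :=
    tendsto_inv_atTop_zero.comp
      (Real.tendsto_sqrt_atTop.comp (tendsto_natCast_atTop_atTop.comp hn))
  refine tendsto_of_tendsto_of_tendsto_of_le_of_le' tendsto_const_nhds h1
    (Eventually.of_forall fun k => by positivity) ?_
  filter_upwards [eventually_rpow_le_Nmin hNmin, (tendsto_Nmin hn hNmin).eventually_gt_atTop 0]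
    with k hk hN
  have hle : ((D k).Nmin : ℝ) ≤ (D k).total := by exact_mod_cast Federation.Nmin_le_total
  exact div_le_inv_sqrt_of_rpow_le (hN.trans_le hle) hN (Nat.cast_nonneg _) hle hk

/-- The oracle estimator is a local minimizer of the objective with probability tending to one. -/
theorem tendsto_measure_oracle (ha : 0 < a) (hsigma : 0 < sigma) (hc₁ : 0 < c₁) (hc₂ : 0 < c₂)
    (hα : 0 ≤ α) (hτ : 0 < τ) (hpen₁ : IsConcavePenalty a pen₁) (hpen₂ : IsConcavePenalty a pen₂)
    (hnoise : ∀ k, (D k).NoiseCond (μ k) sigma c₁ (E k))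
    (hdesign : ∀ k, (D k).DesignCond c₂ c₃ c₄)
    (hn : Tendsto (fun k => (D k).total) atTop atTop)
    (hNmin : MuchLarger (fun k => ((D k).Nmin : ℝ))
      (fun k => ((D k).total : ℝ) ^ (3 / 4 : ℝ) * ((D k).q : ℝ) ^ (1 / 2 : ℝ)))
    (hS : (fun k => Real.log ((D k).numGroups : ℝ)) =O[atTop] (fun k => ((D k).Nmin : ℝ) ^ α))
    (hlam₁ : MuchLarger lam₁ (fun k => ((D k).total : ℝ)
        * √(((D k).q : ℝ) * Real.log ((D k).Nmin : ℝ) / ((D k).Nmin : ℝ) ^ (1 - α))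
        / (((D k).M : ℝ) * ((D k).Gmin : ℝ))))
    (hlam₂ : ∀ᶠ k in atTop, τ * lam₁ k ≤ lam₂ k)
    (hsignal : ∀ C : ℝ, ∀ᶠ k in atTop, ∀ s : (D k).Nonzero,
      a * lam₁ k + C * (D k).rate ≤ ‖(D k).Phi0 s.1‖)
    (hgap : ∀ C : ℝ, ∀ᶠ k in atTop, ∀ (j : Fin (D k).p) (s s' : Fin ((D k).S j)), s ≠ s' →
      a * lam₂ k + C * (D k).rate ≤ ‖(D k).Phi0 ⟨j, s⟩ - (D k).Phi0 ⟨j, s'⟩‖) :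
    Tendsto (fun k => μ k {ω |
          IsLocalMin ((D k).objective pen₁ pen₂ (lam₁ k) (lam₂ k) ((D k).response (E k ω)))
            ((D k).oracle ((D k).response (E k ω)))
          ∧ (D k).IsOracle ((D k).response (E k ω)) ((D k).oracle ((D k).response (E k ω)))})
      atTop (𝓝 1) := by
  rw [← ENNReal.tendsto_toReal_iff (fun k => measure_ne_top _ _) ENNReal.one_ne_top]
  simp only [ENNReal.toReal_one]
  obtain ⟨K, hK, hSK⟩ := hS.exists_pos
  rw [Asymptotics.isBigOWith_iff] at hSK
  -- Score columns have squared norm at most `c₅ * n`.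
  set c₅ := max 1 c₄ with hc₅
  have hc₅0 : 0 < c₅ := lt_max_of_lt_left one_pos
  -- A score below `θ * M * Gmin * lam₁` is dominated by the slopes of both penalties at zero,
  -- since `τ * lam₁ ≤ lam₂`.
  set θ := min (1 / 2) (τ / 4) with hθ
  have hθ0 : 0 < θ := lt_min (by norm_num) (by positivity)
  rw [Metric.tendsto_atTop']
  intro ε hε
  -- With this constant the coefficient error exceeds `C` times the rate with probability at most
  -- `ε / 4`.
  set C := √(4 * sigma ^ 2 / (c₂ * ε)) with hC
  have hC0 : 0 < C := Real.sqrt_pos.2 (by positivity)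
  have hC2 : C ^ 2 = 4 * sigma ^ 2 / (c₂ * ε) := Real.sq_sqrt (by positivity)
  have hntop : Tendsto (fun k => ((D k).total : ℝ)) atTop atTop :=
    tendsto_natCast_atTop_atTop.comp hn
  have hev : ∀ᶠ k in atTop, 1 - ε / 2 ≤ (μ k).real {ω |
          IsLocalMin ((D k).objective pen₁ pen₂ (lam₁ k) (lam₂ k) ((D k).response (E k ω)))
            ((D k).oracle ((D k).response (E k ω)))
          ∧ (D k).IsOracle ((D k).response (E k ω)) ((D k).oracle ((D k).response (E k ω)))} := by
    filter_upwards [hSK, eventually_rpow_le_Nmin hNmin,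
      (tendsto_Nmin hn hNmin).eventually_ge_atTop 3, hntop.eventually_ge_atTop (16 / ε),
      hlam₁ (√(c₅ * (K + 4) / c₁) / θ), hlam₂, hsignal C, hgap (2 * C), hlam₁ 1]
      with k hkS hkN hN3 hkε hk₁ hk₂ hksig hkgap hk1
    have hNn : ((D k).Nmin : ℝ) ≤ (D k).total := by exact_mod_cast Federation.Nmin_le_total
    have hN0 : (0 : ℝ) < (D k).Nmin := by linarith
    have hn0 : (0 : ℝ) < (D k).total := by linarith
    have hM0 : (0 : ℝ) < (D k).M := by exact_mod_cast (D k).M_pos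
    have hG0 : (0 : ℝ) < (D k).Gmin := by exact_mod_cast Federation.Gmin_pos
    have hq1 := one_le_q (D k)
    have hlogN := one_le_log_of_three_le hN3
    have hNα : 0 < ((D k).Nmin : ℝ) ^ α := by positivity
    have hNα' : 0 < ((D k).Nmin : ℝ) ^ (1 - α) := by positivity
    have hl₁ : 0 < lam₁ k := by
      refine lt_of_lt_of_le ?_ hk1
      have : 0 < √(((D k).q : ℝ) * Real.log ((D k).Nmin : ℝ) / ((D k).Nmin : ℝ) ^ (1 - α)) :=
        Real.sqrt_pos.2 (by positivity)
      positivity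
    have hl₂ : 0 < lam₂ k := lt_of_lt_of_le (by positivity) hk₂
    have hSpos : (1 : ℝ) ≤ (D k).numGroups := by
      exact_mod_cast (D k).p_pos.trans_le Federation.p_le_numGroups
    have hlogS : Real.log (D k).numGroups ≤ K * ((D k).Nmin : ℝ) ^ α := by
      rw [Real.norm_eq_abs, Real.norm_eq_abs, abs_of_pos hNα] at hkS
      exact (le_abs_self _).trans hkS
    have hlog := log_le_of_rpow_le hn0 hq1 hkN
    -- At this deviation level the union bound over the groups (at most `exp (K * Nmin ^ α)`), the
    -- client columns (at most `n` per group) and the responses (at most `n`) is `O(1 / n)`.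
    set x := √((K * ((D k).Nmin : ℝ) ^ α + 3 * Real.log (D k).total) / c₁) with hx
    have hlogn : 0 ≤ Real.log (D k).total := Real.log_nonneg (by linarith)
    have hx0 : 0 < x := Real.sqrt_pos.2 (by positivity)
    have hlevel : √(D k).q * (√(c₅ * (D k).total) * x) ≤ θ * ((D k).M * (D k).Gmin * lam₁ k) := by
      refine (noise_level_le (θ := θ) (zero_le_one.trans hq1) hN3 hNn hα hK.le hc₅0 hc₁ hθ0
        hlog).trans ?_
      refine mul_le_mul_of_nonneg_left ?_ hθ0.le
      have := mul_le_mul_of_nonneg_left hk₁ (by positivity : 0 ≤ ((D k).M : ℝ) * (D k).Gmin)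
      refine le_trans (le_of_eq ?_) this
      field_simp
    have hMG : 0 ≤ ((D k).M : ℝ) * (D k).Gmin := by positivity
    have hB₁ : √(D k).q * (√(c₅ * (D k).total) * x) ≤ (D k).M * (D k).Gmin * (lam₁ k / 2) := by
      refine hlevel.trans ?_
      have : θ * ((D k).M * (D k).Gmin * lam₁ k) ≤ 1 / 2 * ((D k).M * (D k).Gmin * lam₁ k) :=
        mul_le_mul_of_nonneg_right (min_le_left _ _) (by positivity)
      linarith
    have hB₂ : √(D k).q * (√(c₅ * (D k).total) * x) ≤ (D k).M * (D k).Gmin * (lam₂ k / 4) := by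
      refine hlevel.trans ?_
      have h1 : θ * ((D k).M * (D k).Gmin * lam₁ k) ≤ τ / 4 * ((D k).M * (D k).Gmin * lam₁ k) :=
        mul_le_mul_of_nonneg_right (min_le_right _ _) (by positivity)
      have h2 := mul_le_mul_of_nonneg_left hk₂ hMG
      linarith
    have hbad₁ : (((D k).numGroups : ℝ) + (D k).M * (D k).p) * (D k).q
        * (2 * Real.exp (-c₁ * x ^ 2)) ≤ ε / 4 := by
      refine (union_bound_le hSpos (by linarith) (Nat.cast_nonneg _) (Nat.cast_nonneg _)
        (by exact_mod_cast Federation.M_le_total) (by exact_mod_cast Federation.p_le_numGroups)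
        ?_ hc₁ hlogS (by positivity)).trans ?_
      · have h1 := div_le_inv_sqrt_of_rpow_le hn0 hN0 (Nat.cast_nonneg _) hNn hkN
        have h2 : (√((D k).total : ℝ))⁻¹ ≤ 1 :=
          inv_le_one_of_one_le₀ (Real.one_le_sqrt.2 (by linarith))
        rw [div_le_iff₀ hN0] at h1
        nlinarith
      · rw [div_le_iff₀ hε] at hkε
        rw [div_le_iff₀ hn0]
        linarith
    have hN0' : 0 < (D k).Nmin := by exact_mod_cast hN0
    rcases Nat.eq_zero_or_pos (D k).numNonzero with hs | hs
    · -- Without nonzero groups the rate vanishes, and no covariate has two different groups.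
      have hemp : IsEmpty (D k).Nonzero := Fintype.card_eq_zero_iff.1 hs
      have hrate : (D k).rate = 0 := by simp [Federation.rate, hs]
      have hzero : ∀ s : (D k).Group, (D k).Phi0 s = 0 := fun s => by
        by_contra h; exact hemp.false ⟨s, h⟩
      have := Federation.one_sub_le_measureReal_oracle hpen₁ hpen₂ hl₁ hl₂ hc₂ hN0' (hdesign k)
        (hnoise k) one_pos hx0 (fun s => (hemp.false s).elim) (fun j s s' hne => by
          have h1 := hkgap j s s' hne
          rw [hrate, hzero, hzero, sub_zero, norm_zero, mul_zero, add_zero] at h1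
          exact absurd h1 (not_le.2 (mul_pos ha hl₂))) hB₁ hB₂
      rw [hs] at this
      simp only [Nat.cast_zero, zero_div, mul_zero, add_zero] at this
      linarith
    · have hs' : (0 : ℝ) < (D k).numNonzero := by exact_mod_cast hs
      have hrate : 0 < (D k).rate := Real.sqrt_pos.2 (by positivity)
      have hrate2 : (D k).rate ^ 2 = (D k).numNonzero * (D k).q / (D k).Nmin :=
        Real.sq_sqrt (by positivity)
      have := Federation.one_sub_le_measureReal_oracle hpen₁ hpen₂ hl₁ hl₂ hc₂ hN0' (hdesign k)
        (hnoise k) (mul_pos hC0 hrate) hx0 hksig (fun j s s' hne => by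
          rw [← mul_assoc]; exact hkgap j s s' hne) hB₁ hB₂
      have e : (D k).q * sigma ^ 2 * ((D k).numNonzero / (c₂ * (D k).Nmin)) / (C * (D k).rate) ^ 2
          = ε / 4 := by
        rw [mul_pow, hC2, hrate2]
        field_simp
      rw [e] at this
      linarith
  obtain ⟨N, hN⟩ := eventually_atTop.1 hev
  refine ⟨N, fun k hk => ?_⟩
  have h1 := hN k hk.le
  rw [Real.dist_eq, abs_lt]
  simp only [Measure.real] at h1
  have h2 := measureReal_le_one (μ := μ k) (s := {ω |
          IsLocalMin ((D k).objective pen₁ pen₂ (lam₁ k) (lam₂ k) ((D k).response (E k ω)))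
            ((D k).oracle ((D k).response (E k ω)))
          ∧ (D k).IsOracle ((D k).response (E k ω)) ((D k).oracle ((D k).response (E k ω)))})
  simp only [Measure.real] at h2
  constructor <;> linarith

/-- The residual variance is consistent, in the form needed for studentization. -/
theorem tendsto_measureReal_inv_sqrt_sigmaSq (hsigma : 0 < sigma) (hc₁ : 0 < c₁) (hc₂ : 0 < c₂)
    (hnoise : ∀ k, (D k).NoiseCond (μ k) sigma c₁ (E k))
    (hdesign : ∀ k, (D k).DesignCond c₂ c₃ c₄)
    (hn : Tendsto (fun k => (D k).total) atTop atTop)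
    (hNmin : MuchLarger (fun k => ((D k).Nmin : ℝ))
      (fun k => ((D k).total : ℝ) ^ (3 / 4 : ℝ) * ((D k).q : ℝ) ^ (1 / 2 : ℝ)))
    {δ : ℝ} (hδ : 0 < δ) :
    Tendsto (fun k => (μ k).real {ω | δ ≤ |sigma * (√((D k).sigmaSq ((D k).response (E k ω))
      ((D k).oracle ((D k).response (E k ω)))))⁻¹ - 1|}) atTop (𝓝 0) := by
  obtain ⟨K, hK0, hK⟩ := Federation.NoiseCond.exists_fourth_moment_bound hc₁
  have hcont : ContinuousAt (fun s : ℝ => sigma * (√s)⁻¹) (sigma ^ 2) := by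
    refine continuousAt_const.mul (Real.continuous_sqrt.continuousAt.inv₀ ?_)
    rw [Real.sqrt_sq hsigma.le]; exact hsigma.ne'
  obtain ⟨η, hη, hball⟩ := Metric.continuousAt_iff.1 hcont δ hδ
  have hval : sigma * (√(sigma ^ 2))⁻¹ = 1 := by
    rw [Real.sqrt_sq hsigma.le, mul_inv_cancel₀ hsigma.ne']
  have hbound : Tendsto (fun k => K / ((D k).total * (η / 2) ^ 2)
      + sigma ^ 2 * (c₃ / c₂ * ((D k).q / (D k).Nmin)) / (η / 2)) atTop (𝓝 0) := by
    have h1 : Tendsto (fun k => K / ((D k).total * (η / 2) ^ 2)) atTop (𝓝 0) :=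
      Tendsto.div_atTop tendsto_const_nhds
        ((tendsto_natCast_atTop_atTop.comp hn).atTop_mul_const (by positivity))
    have h2 := (((tendsto_q_div_Nmin hn hNmin).const_mul (c₃ / c₂)).const_mul
      (sigma ^ 2)).div_const (η / 2)
    simpa using h1.add h2
  refine tendsto_of_tendsto_of_tendsto_of_le_of_le' tendsto_const_nhds hbound
    (Eventually.of_forall fun k => measureReal_nonneg) ?_
  filter_upwards [(tendsto_Nmin hn hNmin).eventually_gt_atTop 0] with k hN
  have hN' : 0 < (D k).Nmin := by exact_mod_cast hN
  have hcN : 0 < c₂ * ((D k).Nmin : ℝ) := by positivity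
  have htot : 0 < (D k).total := hN'.trans_le Federation.Nmin_le_total
  have htot' : (0 : ℝ) < (D k).total := by exact_mod_cast htot
  have h1 := Federation.measureReal_sigmaSq_sub_ge_le
    (isUnit_det_gram hcN (hdesign k).min_eigenvalue) htot (hnoise k) (hK (hnoise k)) hη
  refine (measureReal_mono fun ω hω => ?_).trans (h1.trans (add_le_add ?_ ?_))
  · by_contra hcon
    simp only [Set.mem_ofPred_eq, not_le] at hcon hω
    have := hball (x := (D k).sigmaSq ((D k).response (E k ω))
      ((D k).oracle ((D k).response (E k ω)))) (by rw [Real.dist_eq]; exact hcon)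
    rw [hval, Real.dist_eq] at this
    linarith
  · have hq := one_le_q (D k)
    gcongr
    exact le_mul_of_one_le_right htot'.le hq
  · gcongr
    exact Federation.numNonzero_div_total_le hc₂ hN' (hdesign k)

/-- Asymptotic normality of the studentized contrasts of the oracle estimator. -/
theorem tendstoInDistribution_oracle (hsigma : 0 < sigma) (hc₁ : 0 < c₁) (hc₂ : 0 < c₂)
    (hnoise : ∀ k, (D k).NoiseCond (μ k) sigma c₁ (E k))
    (hdesign : ∀ k, (D k).DesignCond c₂ c₃ c₄)
    (hn : Tendsto (fun k => (D k).total) atTop atTop)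
    (hNmin : MuchLarger (fun k => ((D k).Nmin : ℝ))
      (fun k => ((D k).total : ℝ) ^ (3 / 4 : ℝ) * ((D k).q : ℝ) ^ (1 / 2 : ℝ)))
    (u : (k : ℕ) → EuclideanSpace ℝ (D k).Nonzero)
    (c : (k : ℕ) → EuclideanSpace ℝ (Fin (D k).q)) (hu : ∀ k, ‖u k‖ = 1) (hc : ∀ k, ‖c k‖ = 1) :
    TendstoInDistribution
      (fun k ω => ((D k).stdErr (u k) ((D k).response (E k ω))
          ((D k).oracle ((D k).response (E k ω))))⁻¹
        * (D k).contrast (u k) (c k) ((D k).oracle ((D k).response (E k ω))))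
      atTop (id : ℝ → ℝ) μ (gaussianReal 0 1) := by
  obtain ⟨K, hK0, hK⟩ := Federation.NoiseCond.exists_fourth_moment_bound hc₁
  have hcN : ∀ k, 0 < c₂ * ((D k).Nmin : ℝ) := fun k =>
    mul_pos hc₂ (by exact_mod_cast Federation.Nmin_pos)
  have hE : ∀ k, Measurable (E k) := fun k => (hnoise k).meas
  have hβ : Tendsto (fun k => √(c₃ * (D k).q / (c₂ * (D k).Nmin)) / sigma) atTop (𝓝 0) := by
    have h1 := ((tendsto_q_div_Nmin hn hNmin).const_mul (c₃ / c₂)).sqrt.div_const sigma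
    simpa [mul_div_mul_comm] using h1
  simp_rw [fun k ω => Federation.inv_stdErr_mul_contrast hsigma (u k) (c k) (E k ω)]
  refine tendstoInDistribution_mul_of_tendsto_charFun
    (W := fun k ω => sigma * (√((D k).sigmaSq ((D k).response (E k ω))
      ((D k).oracle ((D k).response (E k ω)))))⁻¹)
    (Z := fun k ω => (D k).standardizedContrast sigma (u k) (c k) (E k ω))
    (fun k => ?_) (fun k => ?_) (fun k => ?_) (fun k => ?_) (fun t => ?_) fun δ hδ =>
    tendsto_measureReal_inv_sqrt_sigmaSq hsigma hc₁ hc₂ hnoise hdesign hn hNmin hδ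
  · have h1 := (Federation.continuous_sigmaSq_oracle_response (D := D k)).measurable.comp (hE k)
    exact (h1.sqrt.inv.const_mul sigma).aemeasurable
  · have h1 := ((Federation.continuous_contrast (u k) (c k)).comp
      (Federation.continuous_oracle.comp Federation.continuous_response)).measurable.comp (hE k)
    exact (h1.const_mul _).aemeasurable
  · exact (Federation.integral_sq_standardizedContrast hsigma (hcN k) (hdesign k) (hnoise k)
      (hu k) (hc k)).1
  · exact (Federation.integral_sq_standardizedContrast hsigma (hcN k) (hdesign k) (hnoise k)
      (hu k) (hc k)).2.le
  · rw [tendsto_iff_norm_sub_tendsto_zero]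
    have h2 := (hβ.mul_const (4 * |t| ^ 3 * ((sigma ^ 2 + K) / sigma ^ 2))).add
      ((hβ.pow 2).mul_const (t ^ 4 * sigma ^ 2 / 4))
    rw [zero_mul, zero_pow two_ne_zero, zero_mul, add_zero] at h2
    exact squeeze_zero (fun k => norm_nonneg _) (fun k =>
      Federation.norm_charFun_standardizedContrast_sub_le hsigma (hcN k) (hdesign k) (hnoise k)
        (hK (hnoise k)) (hu k) (hc k) t) h2

end Sequences

end SROF

end

theorem theorem3
    {Ω : ℕ → Type*} [∀ k, MeasurableSpace (Ω k)]
    (μ : (k : ℕ) → Measure (Ω k)) [∀ k, IsProbabilityMeasure (μ k)]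
    (D : ℕ → SROF.Federation)
    (E : (k : ℕ) → Ω k → (D k).Resp)
    (a sigma c₁ c₂ c₃ c₄ α τ : ℝ)
    (ha : 0 < a) (hsigma : 0 < sigma) (hc₁ : 0 < c₁) (hc₂ : 0 < c₂) (hc₃ : 0 < c₃) (hc₄ : 0 < c₄)
    (hα : α ∈ Set.Ioo (0 : ℝ) (1 / 2)) (hτ : 0 < τ)
    (pen₁ pen₂ : ℝ → ℝ → ℝ)
    (hpen₁ : SROF.IsConcavePenalty a pen₁) (hpen₂ : SROF.IsConcavePenalty a pen₂)
    (lam₁ lam₂ : ℕ → ℝ)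
    (hnoise : ∀ k, (D k).NoiseCond (μ k) sigma c₁ (E k))
    (hdesign : ∀ k, (D k).DesignCond c₂ c₃ c₄)
    (hn : Tendsto (fun k => (D k).total) atTop atTop)
    (hNmin : SROF.MuchLarger (fun k => ((D k).Nmin : ℝ))
      (fun k => ((D k).total : ℝ) ^ (3 / 4 : ℝ) * ((D k).q : ℝ) ^ (1 / 2 : ℝ)))
    (hS : (fun k => Real.log ((D k).numGroups : ℝ)) =O[atTop] (fun k => ((D k).Nmin : ℝ) ^ α))
    (hlam₁ : SROF.MuchLarger lam₁ (fun k => max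
      (((D k).total : ℝ) * (D k).rate / (((D k).M : ℝ) * ((D k).Gmin : ℝ)))
      (((D k).total : ℝ)
        * √(((D k).q : ℝ) * Real.log ((D k).Nmin : ℝ) / ((D k).Nmin : ℝ) ^ (1 - α))
        / (((D k).M : ℝ) * ((D k).Gmin : ℝ)))))
    (hlam₂ : ∀ᶠ k in atTop,
      (2 * lam₁ k * √((D k).q : ℝ)
        + √(1 / c₁) * (√(((D k).numNonzero : ℝ) * ((D k).q : ℝ)
            * Real.log (((D k).numNonzero : ℝ) * ((D k).q : ℝ) * ((D k).total : ℝ)))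
            / ((D k).M : ℝ))
        + τ * lam₁ k * ((D k).Gmin : ℝ)) / ((D k).Gmin : ℝ) ≤ lam₂ k)
    (hlam₂' : SROF.MuchLarger lam₂ (fun k => √(((D k).q : ℝ) / ((D k).Nmin : ℝ))))
    (hsignal : ∀ C : ℝ, ∀ᶠ k in atTop, ∀ s : (D k).Nonzero,
      a * lam₁ k + C * (D k).rate ≤ ‖(D k).Phi0 s.1‖)
    (hgap : ∀ C : ℝ, ∀ᶠ k in atTop, ∀ (j : Fin (D k).p) (s s' : Fin ((D k).S j)), s ≠ s' →
      a * lam₂ k + C * (D k).rate ≤ ‖(D k).Phi0 ⟨j, s⟩ - (D k).Phi0 ⟨j, s'⟩‖) :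
    ∃ Th : (k : ℕ) → Ω k → (D k).Params,
      (∀ k, Measurable (Th k)) ∧
      Tendsto (fun k => μ k {ω |
          IsLocalMin ((D k).objective pen₁ pen₂ (lam₁ k) (lam₂ k) ((D k).response (E k ω))) (Th k ω)
          ∧ (D k).IsOracle ((D k).response (E k ω)) (Th k ω)}) atTop (𝓝 1) ∧
      ∀ (u : (k : ℕ) → EuclideanSpace ℝ (D k).Nonzero)
        (c : (k : ℕ) → EuclideanSpace ℝ (Fin (D k).q)),
        (∀ k, ‖u k‖ = 1) → (∀ k, ‖c k‖ = 1) →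
        TendstoInDistribution
          (fun k ω => ((D k).stdErr (u k) ((D k).response (E k ω)) (Th k ω))⁻¹
            * (D k).contrast (u k) (c k) (Th k ω))
          atTop (id : ℝ → ℝ) μ (gaussianReal 0 1) := by
  have hG : ∀ k, (0 : ℝ) < (D k).Gmin := fun k => by exact_mod_cast SROF.Federation.Gmin_pos
  have hlam₁' : SROF.MuchLarger lam₁ (fun k => ((D k).total : ℝ)
      * √(((D k).q : ℝ) * Real.log ((D k).Nmin : ℝ) / ((D k).Nmin : ℝ) ^ (1 - α))
      / (((D k).M : ℝ) * ((D k).Gmin : ℝ))) := by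
    intro C
    filter_upwards [hlam₁ |C|] with k hk
    refine le_trans ?_ ((mul_le_mul_of_nonneg_left (le_max_right _ _) (abs_nonneg C)).trans hk)
    exact mul_le_mul_of_nonneg_right (le_abs_self C) (by positivity)
  have hlam₁0 : ∀ᶠ k in atTop, 0 ≤ lam₁ k := by
    filter_upwards [hlam₁' 0] with k hk
    simpa using hk
  have hlam₂τ : ∀ᶠ k in atTop, τ * lam₁ k ≤ lam₂ k := by
    filter_upwards [hlam₂, hlam₁0] with k hk h0
    refine le_trans ?_ hk
    rw [le_div_iff₀ (hG k)]
    exact le_add_of_nonneg_left (by positivity)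
  refine ⟨fun k ω => (D k).oracle ((D k).response (E k ω)), fun k => ?_, ?_, ?_⟩
  · exact (SROF.Federation.continuous_oracle.comp
      SROF.Federation.continuous_response).measurable.comp (hnoise k).meas
  · exact SROF.tendsto_measure_oracle ha hsigma hc₁ hc₂ hα.1.le hτ hpen₁ hpen₂ hnoise hdesign hn
      hNmin hS hlam₁' hlam₂τ hsignal hgap
  · exact fun u c hu hc => SROF.tendstoInDistribution_oracle hsigma hc₁ hc₂ hnoise hdesign hn hNmin
      u c hu hc
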